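/- Let $\mathcal M$ be a locally small category with all small limits and colimits, and let $\mathcal M^{\mathbf 2}$ be its arrow category (objects: arrows of $\mathcal M$; morphisms: commutative squares). Let $\mathcal I\hookrightarrow\mathcal M^{\mathbf 2}$ be a (not necessarily full) subcategory. Let $\mathcal I^{\boxslash}$ be the category whose objects are pairs $(f,\phi_f)$, where $f\colon X\to Y$ is an arrow of $\mathcal M$ and $\phi_f$ chooses a solution $\phi_f(j,\sigma)\colon \operatorname{cod} j\to X$ of every lifting problem $\sigma\colon j\to f$ with $j\in\mathcal I$, such that $\phi_f(j',\sigma m)=\phi_f(j,\sigma)\circ\operatorname{cod}(m)$ for every morphism $m\colon j'\to j$ of $\mathcal I$. Its morphisms $(f,\phi_f)\to(f',\phi_{f'})$ are the squares $(u,v)\colon f\to f'$ with $u\circ\phi_f(j,\sigma)=\phi_{f'}(j,(u,v)\sigma)$ for all $j$ and $\sigma$. Dually, ${}^{\boxslash}(\mathcal I^{\boxslash})$ consists of the arrows $g$ equipped with a choice of solutions of all lifting problems of $g$ against the objects of $\mathcal I^{\boxslash}$, natural with respect to the morphisms of $\mathcal I^{\boxslash}$. The same symbols denote the classes of arrows that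 admit such structures. Let $R$ be a pointed endofunctor of $\mathcal M^{\mathbf 2}$ over $\mathrm{cod}$, that is, an endofunctor with a natural transformation $\eta\colon \mathrm{id}\Rightarrow R$ whose codomain components are identities. Let $\mathbf{Alg}_R$ be the category of pairs $(f,\,s\colon Rf\to f)$ with $s\eta_f=\mathrm{id}$, with the evident morphisms. Suppose that there is an isomorphism of categories $\mathcal I^{\boxslash}\cong\mathbf{Alg}_R$ over $\mathcal M^{\mathbf 2}$, and that $R$ satisfies the following condition. $(\dagger)$ There are an orthogonal factorization system $(\mathcal E,\mathcal N)$ on $\mathcal M^{\mathbf 2}$ (a weak factorization system in which liftings, and hence factorizations up to isomorphism, are unique) that is well-copowered (every object has only a set of $\mathcal E$-quotients up to isomorphism), and a regular cardinal $\alpha$, such that $R$ sends every colimit cocone over an $\alpha$-indexed sequence with all legs in $\mathcal N$ to a colimit cocone. Then there is an algebraic weak factorization system $(\mathbb L,\mathbb R)$ on $\mathcal M$ whose underlying weak factorization system is $({}^{\boxslash}(\mathcal I^{\boxslash}),\mathcal I^{\boxslash})$. Explicitly, there is a functorial factorization $f=\mathbb Rf\circ\mathbb Lf$ with a comonad structure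 on $(\mathbb L,\varepsilon)$, whose counit and comultiplication $\delta$ have identity domain components, and a monad structure on $(\mathbb R,\eta)$, whose unit and multiplication $\mu$ have identity codomain components, such that the canonical map $\mathbb L\mathbb R\Rightarrow\mathbb R\mathbb L$ with components $(\operatorname{cod}\delta,\operatorname{dom}\mu)$ is a distributive law; the pair of classes $({}^{\boxslash}(\mathcal I^{\boxslash}),\mathcal I^{\boxslash})$ is a weak factorization system; and these two classes are the retract closures of the classes of arrows underlying $\mathbb L$-coalgebras and $\mathbb R$-algebras, respectively. In particular, every arrow $f\colon X\to Y$ factors as $X\xrightarrow{\mathbb Lf}Z\xrightarrow{\mathbb Rf}Y$ with $\mathbb Lf\in{}^{\boxslash}(\mathcal I^{\boxslash})$ and $\mathbb Rf\in\mathcal I^{\boxslash}$. -/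

import Mathlib

open CategoryTheory CategoryTheory.Limits

universe w' w v u

namespace AlgSOA

section Generalities

/-- An isomorphism of categories `A ≅ A'` over a base category `B`: mutually (strictly) inverse
functors, strictly compatible with the given functors `U : A ⥤ B` and `V : A' ⥤ B`. -/
structure IsoOver {A A' B : Type*} [Category* A] [Category* A'] [Category* B]
    (U : A ⥤ B) (V : A' ⥤ B) where
  /-- the isomorphism -/
  functor : A ⥤ A'
  /-- its inverse -/
  inverse : A' ⥤ A
  functor_comp_inverse : functor ⋙ inverse = 𝟭 A
  inverse_comp_functor : inverse ⋙ functor = 𝟭 A'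
  functor_comp : functor ⋙ V = U

/-- An orthogonal factorization system: a weak factorization system whose liftings are unique.
(Uniqueness of factorizations up to unique isomorphism is
`IsOrthogonalFactorizationSystem.existsUnique_iso` below.) -/
structure IsOrthogonalFactorizationSystem {D : Type u} [Category.{v} D]
    (E M : MorphismProperty D) : Prop where
  wfs : MorphismProperty.IsWeakFactorizationSystem E M
  lift_unique : ∀ {A B X Y : D} (e : A ⟶ B) (m : X ⟶ Y), E e → M m →
    ∀ l l' : B ⟶ X, e ≫ l = e ≫ l' → l ≫ m = l' ≫ m → l = l'

theorem IsOrthogonalFactorizationSystem.existsUnique_iso {D : Type u} [Category.{v} D]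
    {E M : MorphismProperty D} (h : IsOrthogonalFactorizationSystem E M) {X Z Z' Y : D}
    (e : X ⟶ Z) (m : Z ⟶ Y) (e' : X ⟶ Z') (m' : Z' ⟶ Y) (he : E e) (hm : M m) (he' : E e')
    (hm' : M m') (w : e ≫ m = e' ≫ m') :
    ∃! i : Z ≅ Z', e ≫ i.hom = e' ∧ i.hom ≫ m' = m := by
  have := h.wfs
  have h₁ := MorphismProperty.hasLiftingProperty_of_wfs e m' he hm'
  have h₂ := MorphismProperty.hasLiftingProperty_of_wfs e' m he' hm
  have s₁ : CommSq e' e m' m := ⟨w.symm⟩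
  have s₂ : CommSq e e' m m' := ⟨w⟩
  refine ⟨⟨s₁.lift, s₂.lift, ?_, ?_⟩, ⟨s₁.fac_left, s₁.fac_right⟩, ?_⟩
  · exact h.lift_unique e m he hm _ _ (by simp) (by simp)
  · exact h.lift_unique e' m' he' hm' _ _ (by simp) (by simp)
  · rintro j ⟨hj₁, hj₂⟩
    ext
    exact h.lift_unique e m' he hm' _ _ (by simp [hj₁]) (by simp [hj₂])

/-- Every object has only a (small) set of `E`-quotients, up to isomorphism. -/
def WellCopowered {D : Type u} [Category.{v} D] (E : MorphismProperty D) : Prop :=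
  ∀ X : D, ∃ (ι : Type v) (Q : ι → Under X),
    ∀ ⦃Y : D⦄ (e : X ⟶ Y), E e → ∃ i : ι, Nonempty (Under.mk e ≅ Q i)

/-- `R` sends `α`-indexed `M`-colimits to colimits, where a (transfinite) sequence is indexed by
the initial ordinal of `α` and an `M`-colimit is a colimit cocone with all its legs in `M`. -/
def SendsMColimitsToColimits {D : Type u} [Category.{v} D] (R : D ⥤ D)
    (M : MorphismProperty D) (α : Cardinal.{v}) : Prop :=
  ∀ (F : α.ord.ToType ⥤ D) (c : Cocone F), IsColimit c → (∀ j, M (c.ι.app j)) →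
    Nonempty (IsColimit (R.mapCocone c))

/-- Kelly's smallness condition on an endofunctor. -/
def SmallnessCondition {D : Type u} [Category.{v} D] (R : D ⥤ D) : Prop :=
  ∃ (E M : MorphismProperty D) (α : Cardinal.{v}),
    IsOrthogonalFactorizationSystem E M ∧ WellCopowered E ∧ α.IsRegular ∧
      SendsMColimitsToColimits R M α

end Generalities

section Pointed

variable (C : Type u) [Category.{v} C]

/-- A pointed endofunctor of the arrow category over `cod`: an endofunctor `R` with a natural
transformation `𝟭 ⟶ R` whose codomain components are identities. -/
structure PointedEndofunctorOverCod where
  /-- the underlying endofunctor -/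
  R : Arrow C ⥤ Arrow C
  /-- the point -/
  η : 𝟭 (Arrow C) ⟶ R
  right_obj : ∀ f : Arrow C, f.right = (R.obj f).right
  η_right : ∀ f : Arrow C, (η.app f).right = eqToHom (right_obj f)

variable {C}

/-- An algebra for a pointed endofunctor (no associativity is required). -/
structure PointedEndofunctorOverCod.Algebra (T : PointedEndofunctorOverCod C) where
  /-- the underlying object -/
  arrow : Arrow C
  /-- the structure map -/
  a : T.R.obj arrow ⟶ arrow
  unit : T.η.app arrow ≫ a = 𝟙 arrow

/-- A morphism of algebras for a pointed endofunctor. -/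
@[ext]
structure PointedEndofunctorOverCod.Algebra.Hom {T : PointedEndofunctorOverCod C}
    (X Y : T.Algebra) where
  /-- the underlying commutative square -/
  f : X.arrow ⟶ Y.arrow
  comm : T.R.map f ≫ Y.a = X.a ≫ f

instance (T : PointedEndofunctorOverCod C) : Category T.Algebra where
  Hom X Y := PointedEndofunctorOverCod.Algebra.Hom X Y
  id X := ⟨𝟙 _, by simp⟩
  comp g h := ⟨g.f ≫ h.f, by simp [h.comm, reassoc_of% g.comm]⟩

/-- The forgetful functor from algebras to the arrow category. -/
def PointedEndofunctorOverCod.Algebra.forget (T : PointedEndofunctorOverCod C) :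
    T.Algebra ⥤ Arrow C where
  obj X := X.arrow
  map g := g.f

end Pointed

section Lifting

variable {C : Type u} [Category.{v} C] {I : Type w} [Category.{w'} I]

/-- A function choosing a solution to every lifting problem of a map `ι j` (`j` in `I`)
against `f`, naturally with respect to the morphisms of `I`. -/
@[ext]
structure RightLiftingFunction (ι : I ⥤ Arrow C) (f : Arrow C) where
  /-- the chosen lifts -/
  lift : ∀ j : I, (ι.obj j ⟶ f) → ((ι.obj j).right ⟶ f.left)
  fac_left : ∀ j (σ : ι.obj j ⟶ f), (ι.obj j).hom ≫ lift j σ = σ.left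
  fac_right : ∀ j (σ : ι.obj j ⟶ f), lift j σ ≫ f.hom = σ.right
  natural : ∀ {j' j : I} (m : j' ⟶ j) (σ : ι.obj j ⟶ f),
    lift j' (ι.map m ≫ σ) = (ι.map m).right ≫ lift j σ

/-- The objects of the category `I^⧄`. -/
structure RightLifting (ι : I ⥤ Arrow C) where
  /-- the underlying arrow -/
  arrow : Arrow C
  /-- the lifting function -/
  φ : RightLiftingFunction ι arrow

/-- The morphisms of the category `I^⧄`: squares compatible with the chosen lifts. -/
@[ext]
structure RightLifting.Hom {ι : I ⥤ Arrow C} (X Y : RightLifting ι) where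
  /-- the underlying commutative square -/
  f : X.arrow ⟶ Y.arrow
  comm : ∀ j (σ : ι.obj j ⟶ X.arrow), X.φ.lift j σ ≫ f.left = Y.φ.lift j (σ ≫ f)

instance (ι : I ⥤ Arrow C) : Category (RightLifting ι) where
  Hom X Y := RightLifting.Hom X Y
  id X := ⟨𝟙 _, by simp⟩
  comp g h := ⟨g.f ≫ h.f, fun j σ ↦ by
    rw [Arrow.comp_left, ← Category.assoc, g.comm, h.comm, Category.assoc]⟩

/-- The forgetful functor from `I^⧄` to the arrow category. -/
def RightLifting.forget (ι : I ⥤ Arrow C) : RightLifting ι ⥤ Arrow C where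
  obj X := X.arrow
  map g := g.f

/-- A function choosing a solution to every lifting problem of `f` against a map `U k`
(`k` in `K`), naturally with respect to the morphisms of `K`. -/
@[ext]
structure LeftLiftingFunction {K : Type w} [Category.{w'} K] (U : K ⥤ Arrow C)
    (f : Arrow C) where
  /-- the chosen lifts -/
  lift : ∀ k : K, (f ⟶ U.obj k) → (f.right ⟶ (U.obj k).left)
  fac_left : ∀ k (σ : f ⟶ U.obj k), f.hom ≫ lift k σ = σ.left
  fac_right : ∀ k (σ : f ⟶ U.obj k), lift k σ ≫ (U.obj k).hom = σ.right
  natural : ∀ {k k' : K} (m : k ⟶ k') (σ : f ⟶ U.obj k),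
    lift k' (σ ≫ U.map m) = lift k σ ≫ (U.map m).left

/-- The class of morphisms underlying `I^⧄`. -/
def rightClass (ι : I ⥤ Arrow C) : MorphismProperty C :=
  fun _ _ f ↦ Nonempty (RightLiftingFunction ι (Arrow.mk f))

/-- The class of morphisms underlying `⧄(I^⧄)`. -/
def leftClass (ι : I ⥤ Arrow C) : MorphismProperty C :=
  fun _ _ f ↦ Nonempty (LeftLiftingFunction (RightLifting.forget ι) (Arrow.mk f))

end Lifting

section AWFS

variable (C : Type u) [Category.{v} C]

/-- A functorial factorization: a functor `Z : Arrow C ⥤ C` with natural maps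
`i : dom ⟶ Z` and `p : Z ⟶ cod` such that `i ≫ p` is the canonical map `dom ⟶ cod`. -/
abbrev FunctorialFactorization :=
  MorphismProperty.FunctorialFactorizationData (⊤ : MorphismProperty C) (⊤ : MorphismProperty C)

variable {C}

namespace FunctorialFactorization

variable (F : FunctorialFactorization C)

theorem fac_app' (f : Arrow C) : F.i.app f ≫ F.p.app f = f.hom :=
  congr_app F.fac f

/-- The endofunctor `f ↦ L f` (left factor). -/
def L : Arrow C ⥤ Arrow C where
  obj f := Arrow.mk (F.i.app f)
  map {f g} s := Arrow.homMk s.left (F.Z.map s) (F.i.naturality s)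

/-- The endofunctor `f ↦ R f` (right factor). -/
def R : Arrow C ⥤ Arrow C where
  obj f := Arrow.mk (F.p.app f)
  map {f g} s := Arrow.homMk (F.Z.map s) s.right (F.p.naturality s)

/-- The counit `ε : L ⟶ 𝟭`, with domain components identities. -/
def ε : F.L ⟶ 𝟭 (Arrow C) where
  app f := Arrow.homMk (𝟙 f.left) (F.p.app f)
    ((Category.id_comp _).trans (F.fac_app' f).symm)
  naturality f g s := by
    ext
    · exact (Category.comp_id s.left).trans (Category.id_comp s.left).symm
    · exact F.p.naturality s

/-- The unit `η : 𝟭 ⟶ R`, with codomain components identities. -/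
def η : 𝟭 (Arrow C) ⟶ F.R where
  app f := Arrow.homMk (F.i.app f) (𝟙 f.right)
    ((F.fac_app' f).trans (Category.comp_id _).symm)
  naturality f g s := by
    ext
    · exact F.i.naturality s
    · exact (Category.comp_id s.right).trans (Category.id_comp s.right).symm

end FunctorialFactorization

variable (C) in
/-- A functorial factorization with a comonad structure on `(L, ε)` and a monad structure on
`(R, η)`, such that the domain components of `δ` and the codomain components of `μ` are
identities. -/
structure PreAlgebraicWFS where
  /-- the functorial factorization -/
  F : FunctorialFactorization C
  /-- the comultiplication -/
  δ : F.L ⟶ F.L ⋙ F.L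
  δ_left : ∀ f : Arrow C, (δ.app f).left = 𝟙 f.left
  coassoc : ∀ f, δ.app f ≫ F.L.map (δ.app f) = δ.app f ≫ δ.app (F.L.obj f)
  left_counit : ∀ f, δ.app f ≫ F.ε.app (F.L.obj f) = 𝟙 (F.L.obj f)
  right_counit : ∀ f, δ.app f ≫ F.L.map (F.ε.app f) = 𝟙 (F.L.obj f)
  /-- the multiplication -/
  μ : F.R ⋙ F.R ⟶ F.R
  μ_right : ∀ f : Arrow C, (μ.app f).right = 𝟙 f.right
  assoc : ∀ f, F.R.map (μ.app f) ≫ μ.app f = μ.app (F.R.obj f) ≫ μ.app f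
  left_unit : ∀ f, F.η.app (F.R.obj f) ≫ μ.app f = 𝟙 (F.R.obj f)
  right_unit : ∀ f, F.R.map (F.η.app f) ≫ μ.app f = 𝟙 (F.R.obj f)

namespace PreAlgebraicWFS

variable (A : PreAlgebraicWFS C)

/-- The comonad of the system. -/
def comonad : Comonad (Arrow C) where
  toFunctor := A.F.L
  ε := A.F.ε
  δ := A.δ
  coassoc := A.coassoc
  left_counit := A.left_counit
  right_counit := A.right_counit

/-- The monad of the system. -/
def monad : Monad (Arrow C) where
  toFunctor := A.F.R
  η := A.F.η
  μ := A.μ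
  assoc := A.assoc
  left_unit := A.left_unit
  right_unit := A.right_unit

/-- The canonical square `L (R f) ⟶ R (L f)` with components the codomain component of `δ`
and the domain component of `μ`. -/
def Δ (f : Arrow C) : A.F.L.obj (A.F.R.obj f) ⟶ A.F.R.obj (A.F.L.obj f) :=
  Arrow.homMk (A.δ.app f).right (A.μ.app f).left (by
    have h₁ : (A.δ.app f).right ≫ A.F.p.app (A.F.L.obj f) = 𝟙 (A.F.Z.obj f) :=
      congrArg Arrow.Hom.right (A.left_counit f)
    have h₂ : A.F.i.app (A.F.R.obj f) ≫ (A.μ.app f).left = 𝟙 (A.F.Z.obj f) :=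
      congrArg Arrow.Hom.left (A.left_unit f)
    exact h₁.trans h₂.symm)

end PreAlgebraicWFS

variable (C) in
/-- An algebraic weak factorization system: a comonad and a monad arising from a
functorial factorization, such that the canonical map `L R ⟶ R L` is a distributive law of the
comonad over the monad. (Naturality of this map is automatic.) -/
structure AlgebraicWFS extends PreAlgebraicWFS C where
  distrib_unit : ∀ f, F.L.map (F.η.app f) ≫ toPreAlgebraicWFS.Δ f = F.η.app (F.L.obj f)
  distrib_counit : ∀ f, toPreAlgebraicWFS.Δ f ≫ F.R.map (F.ε.app f) = F.ε.app (F.R.obj f)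
  distrib_mul : ∀ f, F.L.map (μ.app f) ≫ toPreAlgebraicWFS.Δ f =
    toPreAlgebraicWFS.Δ (F.R.obj f) ≫ F.R.map (toPreAlgebraicWFS.Δ f) ≫ μ.app (F.L.obj f)
  distrib_comul : ∀ f, δ.app (F.R.obj f) ≫ F.L.map (toPreAlgebraicWFS.Δ f) ≫
    toPreAlgebraicWFS.Δ (F.L.obj f) = toPreAlgebraicWFS.Δ f ≫ F.R.map (δ.app f)

namespace AlgebraicWFS

variable (A : AlgebraicWFS C)

/-- The underlying left class: the retract closure of the coalgebras for the comonad. -/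
def left : MorphismProperty C :=
  MorphismProperty.retracts fun _ _ f ↦ ∃ X : A.comonad.Coalgebra, X.A = Arrow.mk f

/-- The underlying right class: the retract closure of the algebras for the monad. -/
def right : MorphismProperty C :=
  MorphismProperty.retracts fun _ _ f ↦ ∃ X : A.monad.Algebra, X.A = Arrow.mk f

end AlgebraicWFS

end AWFS

end AlgSOA

/-! The theorem reduces to the existence of free objects for `RightLifting.forget ι`. Through the
isomorphism over the arrow category these are free algebras for a pointed endofunctor `T`, obtained
from Kelly's transfinite sequence. Its stages live in `Comma T (𝟭 D)`: an object `T Y ⟶ Z` counts as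
an algebra when the induced map `Y ⟶ Z` is invertible, and every step is local, i.e. maps into
algebras extend uniquely along it.

The smallness condition concerns only colimits with legs in `M`, which the legs of this sequence
need not be. Each step therefore also absorbs all `E`-quotients of the current stage that any
further local map could realise; well-copoweredness makes them a set, and also forces `E` to consist
of epimorphisms (`WellCopowered.epi`). The sequence of `E`-images in the colimit then interleaves
with the original one, so `T` preserves its colimit (`nonempty_isColimit_mapCocone_of_stable`) and
the colimit is an algebra (`exists_isLocal_isAlgebra`).

Since lifting functions pull back, the unit into a free object is invertible on codomains
(`isIso_right_of_free`), so free objects form a functorial factorization. The multiplication extends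
an identity; the comultiplication extends `i (L f)` into the vertical composite of the free lifting
functions on `R (L f)` and `R f`. The axioms not built into these constructions compare two
lift-preserving squares out of a free object that agree along the unit (`extension_ext`). -/

namespace AlgSOA

/-! ### Well-copoweredness and epimorphisms -/

section WellCopowered

variable {D : Type u} [Category.{v} D]

/-- In a cocomplete category, well-copoweredness forces the left class to consist of
epimorphisms, by Freyd's cardinality argument. -/
theorem WellCopowered.epi [HasColimits D] {E M : MorphismProperty D}
    [MorphismProperty.IsWeakFactorizationSystem E M] (hE : WellCopowered E)
    {X Y : D} (e : X ⟶ Y) (he : E e) : Epi e := by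
  refine ⟨fun {T} a b hab ↦ ?_⟩
  by_contra hne
  obtain ⟨κ, Q, hQ⟩ := hE X
  -- `S` collects all maps to `T` from all representatives of `E`-quotients of `X`. The wide pushout
  -- of `S` copies of `e` is again an `E`-quotient, yet it admits at least `2 ^ S` maps to `T`.
  let S : Type v := Σ i, ((Q i).right ⟶ T)
  have hhead : E (WidePushout.head (fun _ : S ↦ e)) := by
    rw [← MorphismProperty.llp_eq_of_wfs E M]
    intro A B n hn
    have := MorphismProperty.hasLiftingProperty_of_wfs e n he hn
    refine ⟨fun {f g} sq ↦ ?_⟩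
    have s (j : S) : CommSq f e n (WidePushout.ι (fun _ : S ↦ e) j ≫ g) :=
      ⟨sq.w.trans (WidePushout.arrow_ι_assoc (fun _ : S ↦ e) j g).symm⟩
    refine ⟨⟨⟨WidePushout.desc f (fun j ↦ (s j).lift) (fun j ↦ (s j).fac_left),
      WidePushout.head_desc _ _ _ _, ?_⟩⟩⟩
    apply WidePushout.hom_ext
    · intro j
      rw [WidePushout.ι_desc_assoc, (s j).fac_right]
    · rw [WidePushout.head_desc_assoc, sq.w]
  obtain ⟨i, ⟨φ⟩⟩ := hQ _ hhead
  classical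
  let g (A : Set S) : widePushout X (fun _ : S ↦ Y) (fun _ ↦ e) ⟶ T :=
    WidePushout.desc (e ≫ a) (fun s ↦ if s ∈ A then a else b) (fun s ↦ by
      split_ifs
      · rfl
      · exact hab.symm)
  have hg (A : Set S) (s : S) : WidePushout.ι (fun _ : S ↦ e) s ≫ g A = if s ∈ A then a else b :=
    WidePushout.ι_desc _ _ _ _ _
  -- A subset of `S` is recovered from `g A` by restricting to each copy of `Y`, because `a ≠ b`; so
  -- `Set S` would inject into `S`.
  refine Function.cantor_injective (fun A : Set S ↦ (⟨i, φ.inv.right ≫ g A⟩ : S)) ?_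
  intro A B hAB
  have h : φ.inv.right ≫ g A = φ.inv.right ≫ g B := eq_of_heq (Sigma.mk.inj hAB).2
  have h' : g A = g B := by
    have hφ : φ.hom.right ≫ φ.inv.right = 𝟙 _ := by
      rw [← Under.comp_right, φ.hom_inv_id]; rfl
    have := φ.hom.right ≫= h
    rw [← Category.assoc, ← Category.assoc, hφ] at this
    simpa using this
  ext s
  have := WidePushout.ι (fun _ : S ↦ e) s ≫= h'
  rw [hg, hg] at this
  split_ifs at this with h₁ h₂ h₂
  · tauto
  · exact absurd this hne
  · exact absurd this.symm hne
  · tauto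

end WellCopowered

/-! ### Colimits in the comma category -/

section CommaColimits

variable {J : Type w} [Category.{w'} J] {A : Type*} [Category* A] {B : Type*} [Category* B]
  (L : A ⥤ B) [HasColimitsOfShape J B]
  (F : J ⥤ Comma L (𝟭 B))

/-- The canonical map `colim (L ∘ left) ⟶ colim right` for a diagram in `Comma L (𝟭 B)`. -/
noncomputable def Comma.colimHom :
    colimit ((F ⋙ Comma.fst L (𝟭 B)) ⋙ L) ⟶ colimit (F ⋙ Comma.snd L (𝟭 B)) :=
  colimit.desc _ (Cocone.mk _
    { app := fun j ↦ (F.obj j).hom ≫ colimit.ι (F ⋙ Comma.snd L (𝟭 B)) j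
      naturality := fun i j f ↦ by
        have h₁ := (F.map f).w
        have h₂ := colimit.w (F ⋙ Comma.snd L (𝟭 B)) f
        have h₃ : L.map (F.map f).left ≫ (F.obj j).hom ≫ colimit.ι (F ⋙ Comma.snd L (𝟭 B)) j =
            (F.obj i).hom ≫ colimit.ι (F ⋙ Comma.snd L (𝟭 B)) i := by
          rw [← h₂, ← Category.assoc, h₁, Category.assoc]
          rfl
        exact h₃.trans (Category.comp_id _).symm })

lemma Comma.ι_colimHom (j : J) : colimit.ι ((F ⋙ Comma.fst L (𝟭 B)) ⋙ L) j ≫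
    Comma.colimHom L F = (F.obj j).hom ≫ colimit.ι (F ⋙ Comma.snd L (𝟭 B)) j :=
  colimit.ι_desc _ _

lemma Comma.ι_colimHom_assoc (j : J) {X : B} (k : colimit (F ⋙ Comma.snd L (𝟭 B)) ⟶ X) :
    colimit.ι ((F ⋙ Comma.fst L (𝟭 B)) ⋙ L) j ≫ Comma.colimHom L F ≫ k =
      (F.obj j).hom ≫ colimit.ι (F ⋙ Comma.snd L (𝟭 B)) j ≫ k :=
  (Category.assoc _ _ _).symm.trans
    ((congr_arg (· ≫ k) (Comma.ι_colimHom L F j)).trans (Category.assoc _ _ _))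

variable [HasColimitsOfShape J A] [HasPushouts B]

/-- The colimit cocone of a diagram in `Comma L (𝟭 B)`, without assumptions on `L`. -/
noncomputable def Comma.pushoutCocone : Cocone F where
  pt :=
    { left := colimit (F ⋙ Comma.fst L (𝟭 B))
      -- The pushout replaces `colim (L ∘ left)` by `L (colim left)`, which compensates for `L` not
      -- preserving the colimit.
      right := pushout (colimit.post (F ⋙ Comma.fst L (𝟭 B)) L) (Comma.colimHom L F)
      hom := pushout.inl _ _ }
  ι :=
    { app := fun j ↦
        { left := colimit.ι (F ⋙ Comma.fst L (𝟭 B)) j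
          right := colimit.ι (F ⋙ Comma.snd L (𝟭 B)) j ≫ pushout.inr _ _
          w := by
            have h := colimit.ι ((F ⋙ Comma.fst L (𝟭 B)) ⋙ L) j ≫=
              pushout.condition (f := colimit.post (F ⋙ Comma.fst L (𝟭 B)) L)
                (g := Comma.colimHom L F)
            rw [colimit.ι_post_assoc, Comma.ι_colimHom_assoc] at h
            exact h }
      naturality := fun i j f ↦ by
        ext
        · simpa using colimit.w (F ⋙ Comma.fst L (𝟭 B)) f
        · have h := colimit.w_assoc (F ⋙ Comma.snd L (𝟭 B)) f
            (pushout.inr (colimit.post (F ⋙ Comma.fst L (𝟭 B)) L) (Comma.colimHom L F))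
          exact h.trans (Category.comp_id _).symm }

/-- `Comma.pushoutCocone` is a colimit cocone. -/
noncomputable def Comma.isColimitPushoutCocone : IsColimit (Comma.pushoutCocone L F) where
  desc s :=
    { left := colimit.desc _ ((Comma.fst L (𝟭 B)).mapCocone s)
      right := pushout.desc
        (L.map (colimit.desc _ ((Comma.fst L (𝟭 B)).mapCocone s)) ≫ s.pt.hom)
        (colimit.desc _ ((Comma.snd L (𝟭 B)).mapCocone s)) (by
          apply colimit.hom_ext
          intro j
          have := (s.ι.app j).w
          rw [colimit.ι_post_assoc, ← L.map_comp_assoc, colimit.ι_desc, Comma.ι_colimHom_assoc,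
            colimit.ι_desc]
          exact this)
      w := (pushout.inl_desc _ _ _).symm }
  fac s j := by
    ext
    · exact colimit.ι_desc _ _
    · dsimp [Comma.pushoutCocone]
      rw [Category.assoc, pushout.inr_desc]
      exact colimit.ι_desc _ _
  uniq s m hm := by
    have h : m.left = colimit.desc _ ((Comma.fst L (𝟭 B)).mapCocone s) := by
      apply colimit.hom_ext
      intro j
      rw [colimit.ι_desc]
      exact congr_arg CommaMorphism.left (hm j)
    ext
    · exact h
    · dsimp
      apply pushout.hom_ext
      · rw [pushout.inl_desc, ← h]
        exact m.w.symm
      · rw [pushout.inr_desc]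
        apply colimit.hom_ext
        intro j
        rw [colimit.ι_desc]
        refine (Category.assoc _ _ _).symm.trans ?_
        exact congr_arg CommaMorphism.right (hm j)

instance Comma.hasColimitsOfShape_toIdentity : HasColimitsOfShape J (Comma L (𝟭 B)) where
  has_colimit F := ⟨⟨_, Comma.isColimitPushoutCocone L F⟩⟩

instance Comma.preservesColimitsOfShape_fst_toIdentity :
    PreservesColimitsOfShape J (Comma.fst L (𝟭 B)) where
  preservesColimit {F} := preservesColimit_of_preserves_colimit_cocone
    (Comma.isColimitPushoutCocone L F) (IsColimit.ofIsoColimit (colimit.isColimit _)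
      (Cocone.ext (Iso.refl _) (fun j ↦ by exact Category.comp_id _)))

end CommaColimits

/-! ### Local maps and steps of the free algebra sequence -/

namespace PointedStage

variable {D : Type u} [Category.{v} D] {T : D ⥤ D} (η : 𝟭 D ⟶ T)

/-- The composite of the point with the structure map of an object `T Y ⟶ Z` of
`Comma T (𝟭 D)`. -/
def point (p : Comma T (𝟭 D)) : p.left ⟶ p.right := η.app p.left ≫ p.hom

lemma point_naturality {p q : Comma T (𝟭 D)} (f : p ⟶ q) :
    f.left ≫ point η q = point η p ≫ f.right := by
  have h₁ := η.naturality f.left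
  have h₂ := f.w
  dsimp [point] at h₁ h₂ ⊢
  rw [← Category.assoc, h₁, Category.assoc, h₂, Category.assoc]

lemma point_naturality_assoc {p q : Comma T (𝟭 D)} (f : p ⟶ q) {X : D} (k : q.right ⟶ X) :
    f.left ≫ point η q ≫ k = point η p ≫ f.right ≫ k := by
  rw [← Category.assoc, point_naturality, Category.assoc]

lemma map_hom {p q : Comma T (𝟭 D)} (f : p ⟶ q) :
    T.map f.left ≫ q.hom = p.hom ≫ f.right := f.w

lemma app_map {X Y : D} (f : X ⟶ Y) : η.app X ≫ T.map f = f ≫ η.app Y :=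
  (η.naturality f).symm

lemma app_map_assoc {X Y Z : D} (f : X ⟶ Y) (k : T.obj Y ⟶ Z) :
    η.app X ≫ T.map f ≫ k = f ≫ η.app Y ≫ k := by
  rw [← Category.assoc, app_map, Category.assoc]

/-- The objects of `Comma T (𝟭 D)` that are, up to isomorphism, algebras for the pointed
endofunctor `(T, η)`. -/
def isAlgebra : ObjectProperty (Comma T (𝟭 D)) := fun p ↦ IsIso (point η p)

section Succ

variable [HasCoequalizers D] (p : Comma T (𝟭 D))

/-- The next term of the free algebra sequence. -/
noncomputable def succ : Comma T (𝟭 D) where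
  left := p.right
  right := coequalizer (X := T.obj p.left) (Y := T.obj p.right)
    (p.hom ≫ η.app p.right) (T.map (point η p))
  hom := coequalizer.π (X := T.obj p.left) (Y := T.obj p.right)
    (p.hom ≫ η.app p.right) (T.map (point η p))

lemma succ_condition : p.hom ≫ η.app p.right ≫ (succ η p).hom =
    T.map (point η p) ≫ (succ η p).hom :=
  (Category.assoc _ _ _).symm.trans
    (coequalizer.condition (X := T.obj p.left) (Y := T.obj p.right)
      (p.hom ≫ η.app p.right) (T.map (point η p)))

/-- The connecting map of the free algebra sequence. -/
noncomputable def toSucc : p ⟶ succ η p where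
  left := point η p
  right := point η (succ η p)
  w := (succ_condition η p).symm

/-- Invertibility of `point η q` forces the left component of an extension to be the given right
component followed by `inv (point η q)`; the right component is then dictated by the coequalizer.
Conversely, this formula satisfies the coequalizer condition. -/
lemma isLocal_toSucc : (isAlgebra η).isLocal (toSucc η p) := by
  intro q hq
  have : IsIso (point η q) := hq
  constructor
  · intro f g hfg
    have hr (f : succ η p ⟶ q) : f.left = (toSucc η p ≫ f).right ≫ inv (point η q) := by
      exact (IsIso.eq_comp_inv (point η q)).2 (point_naturality η f)
    have hl : f.left = g.left := by rw [hr f, hr g]; congr 2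
    ext
    · exact hl
    · refine coequalizer.hom_ext ?_
      have h₁ := map_hom f
      have h₂ := map_hom g
      rw [hl] at h₁
      exact h₁.symm.trans h₂
  · intro m
    let x : p.right ⟶ q.left := m.right ≫ inv (point η q)
    have hx : x ≫ point η q = m.right := by simp [x]
    have hpx : point η p ≫ x = m.left := by
      rw [← cancel_mono (point η q), Category.assoc, hx, point_naturality]
    have hc : (p.hom ≫ η.app p.right) ≫ T.map x ≫ q.hom =
        T.map (point η p) ≫ T.map x ≫ q.hom := by
      rw [← T.map_comp_assoc, hpx, map_hom, Category.assoc, ← hx]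
      exact congr_arg (p.hom ≫ ·) (app_map_assoc η x q.hom)
    have hd := coequalizer.π_desc (X := T.obj p.left) (Y := T.obj p.right)
      (f := p.hom ≫ η.app p.right) (g := T.map (point η p)) (T.map x ≫ q.hom) hc
    let m' : succ η p ⟶ q :=
      { left := x
        right := coequalizer.desc (X := T.obj p.left) (Y := T.obj p.right)
          (f := p.hom ≫ η.app p.right) (g := T.map (point η p)) (T.map x ≫ q.hom) hc
        w := hd.symm }
    refine ⟨m', ?_⟩
    ext
    · exact hpx
    · refine ((point_naturality η m').symm.trans ?_)
      exact hx

end Succ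

section Stable

variable [HasColimits D] {E M : MorphismProperty D}

/-- Every object has a local extension in which its `E`-images have stabilized. -/
theorem exists_stable_extension (hE : WellCopowered E) (p : Comma T (𝟭 D)) :
    ∃ (p' : Comma T (𝟭 D)) (f : p ⟶ p'), (isAlgebra η).isLocal f ∧
      ∀ ⦃p'' : Comma T (𝟭 D)⦄ (g : p' ⟶ p''), (isAlgebra η).isLocal g →
        ∀ ⦃B : D⦄ (e : p.left ⟶ B) (n : B ⟶ p''.left), E e → e ≫ n = f.left ≫ g.left →
          ∃ r : B ⟶ p'.left, e ≫ r = f.left := by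
  obtain ⟨κ, Q, hQ⟩ := hE p.left
  -- `K` selects the quotients that some local map out of `p` realises. The wide pushout of one such
  -- map for each of them is still local and realises all of them at once. Any quotient realised
  -- after a further local map was thus already selected.
  let K : κ → Prop := fun i ↦ ∃ (p' : Comma T (𝟭 D)) (h : p ⟶ p') (r : (Q i).right ⟶ p'.left),
    (isAlgebra η).isLocal h ∧ (Q i).hom ≫ r = h.left
  choose q h r hloc hr using fun i : {i // K i} ↦ i.2
  have hW : HasColimitsOfShape (WidePushoutShape {i // K i}) (Comma T (𝟭 D)) := inferInstance
  have hhead : (isAlgebra η).isLocal (WidePushout.head h) := by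
    intro a ha
    constructor
    · intro f g hfg
      apply WidePushout.hom_ext
      · intro j
        apply (hloc j a ha).1
        simpa [WidePushout.arrow_ι_assoc] using hfg
      · exact hfg
    · intro m
      choose m' hm' using fun j ↦ (hloc j a ha).2 m
      exact ⟨WidePushout.desc m m' hm', WidePushout.head_desc _ _ _ _⟩
  refine ⟨_, WidePushout.head h, hhead, ?_⟩
  intro p'' g hg B e n he hen
  obtain ⟨i, ⟨φ⟩⟩ := hQ e he
  have hφ : (Q i).hom ≫ φ.inv.right = e := by simp
  have hφ' : e ≫ φ.hom.right = (Q i).hom := by simpa using Under.w φ.hom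
  have hi : K i := ⟨p'', WidePushout.head h ≫ g, φ.inv.right ≫ n,
    (isAlgebra η).isLocal.comp_mem _ _ hhead hg, by
      rw [← Category.assoc, hφ, hen]; rfl⟩
  refine ⟨φ.hom.right ≫ r ⟨i, hi⟩ ≫ (WidePushout.ι h ⟨i, hi⟩).left, ?_⟩
  rw [← Category.assoc, hφ']
  exact ((Category.assoc _ _ _).symm.trans (congr_arg (· ≫ _) (hr ⟨i, hi⟩))).trans
    (congr_arg CommaMorphism.left (WidePushout.arrow_ι h ⟨i, hi⟩))

/-- A local extension which is a step of the free algebra sequence, and in which the `E`-images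
have stabilized. -/
structure IsStep (E : MorphismProperty D) {p p' : Comma T (𝟭 D)} (f : p ⟶ p') : Prop where
  isLocal : (isAlgebra η).isLocal f
  exists_section : ∃ z : p.right ⟶ p'.left, point η p ≫ z = f.left ∧ z ≫ point η p' = f.right
  stable : ∀ ⦃p'' : Comma T (𝟭 D)⦄ (g : p' ⟶ p''), (isAlgebra η).isLocal g →
    ∀ ⦃B : D⦄ (e : p.left ⟶ B) (n : B ⟶ p''.left), E e → e ≫ n = f.left ≫ g.left →
      ∃ r : B ⟶ p'.left, e ≫ r = f.left

/-- A stable extension `f : p ⟶ p₁` is followed by `toSucc`. As `succ η p₁` has left object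
`p₁.right`, the required diagonal is `f.right` itself. -/
theorem exists_isStep (hE : WellCopowered E) (p : Comma T (𝟭 D)) :
    ∃ (p' : Comma T (𝟭 D)) (f : p ⟶ p'), IsStep η E f := by
  obtain ⟨p₁, f, hf, hs⟩ := exists_stable_extension η hE p
  refine ⟨succ η p₁, f ≫ toSucc η p₁,
    (isAlgebra η).isLocal.comp_mem _ _ hf (isLocal_toSucc η p₁), ⟨f.right, ?_, rfl⟩, ?_⟩
  · exact (point_naturality η f).symm
  · intro p'' g hg B e n he hen
    obtain ⟨r, hr⟩ := hs (toSucc η p₁ ≫ g)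
      ((isAlgebra η).isLocal.comp_mem _ _ (isLocal_toSucc η p₁) hg) e n he
      (hen.trans (Category.assoc _ _ _))
    refine ⟨r ≫ point η p₁, ?_⟩
    exact (Category.assoc _ _ _).symm.trans (congr_arg (· ≫ point η p₁) hr)

end Stable

end PointedStage

/-! ### Replacing a colimit by an `M`-colimit -/

section Interleaving

variable {D : Type u} [Category.{v} D] {E M : MorphismProperty D}
  [MorphismProperty.IsWeakFactorizationSystem E M]
  {J : Type w} [LinearOrder J] [SuccOrder J]

/-- If the `E`-images of the terms of a sequence in its colimit are already attained at the next
stage, then the colimit can be rewritten as an `M`-colimit, even after applying a functor. -/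
theorem nonempty_isColimit_mapCocone_of_stable (hepi : ∀ ⦃X Y : D⦄ (e : X ⟶ Y), E e → Epi e)
    {T : D ⥤ D}
    (hT : ∀ (F : J ⥤ D) (c : Cocone F), IsColimit c → (∀ j, M (c.ι.app j)) →
      Nonempty (IsColimit (T.mapCocone c)))
    {Y : J ⥤ D} {c : Cocone Y} (hc : IsColimit c)
    (hr : ∀ (j : J) ⦃B : D⦄ (e : Y.obj j ⟶ B) (n : B ⟶ c.pt), E e → e ≫ n = c.ι.app j →
      ∃ r : B ⟶ Y.obj (Order.succ j), e ≫ r = Y.map (homOfLE (Order.le_succ j))) :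
    Nonempty (IsColimit (T.mapCocone c)) := by
  let d (j : J) := MorphismProperty.factorizationData E M (c.ι.app j)
  have hd (j : J) : (d j).i ≫ (d j).p = c.ι.app j := (d j).fac
  have he (j : J) : Epi (d j).i := hepi _ (d j).hi
  -- With `Z j` the `E`-image of `Y j` in the colimit, the maps `Y j ⟶ Z j ⟶ Y (succ j)` interleave
  -- the two sequences.
  choose r hr using fun j ↦ hr j (d j).i (d j).p (d j).hi (hd j)
  have hrn (j : J) : r j ≫ c.ι.app (Order.succ j) = (d j).p := by
    rw [← cancel_epi (d j).i, reassoc_of% (hr j), c.w, hd]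
  have sq {i j : J} (f : i ⟶ j) : CommSq (Y.map f ≫ (d j).i) (d i).i (d j).p (d i).p :=
    ⟨by rw [Category.assoc, hd, hd, c.w]⟩
  have hl (i j : J) : HasLiftingProperty (d i).i (d j).p :=
    MorphismProperty.hasLiftingProperty_of_wfs _ _ (d i).hi (d j).hp
  let l {i j : J} (f : i ⟶ j) : (d i).Z ⟶ (d j).Z := (sq f).lift
  have hZ {i j : J} (f : i ⟶ j) : (d i).i ≫ l f = Y.map f ≫ (d j).i := (sq f).fac_left
  let Z : J ⥤ D :=
    { obj := fun j ↦ (d j).Z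
      map := l
      map_id := fun j ↦ by
        rw [← cancel_epi (d j).i, hZ]; simp
      map_comp := fun {i j k} f g ↦ by
        rw [← cancel_epi (d i).i, hZ, reassoc_of% (hZ f), hZ g]
        simp }
  let cZ : Cocone Z :=
    { pt := c.pt
      ι :=
        { app := fun j ↦ (d j).p
          naturality := fun i j f ↦ ((sq f).fac_right).trans (Category.comp_id _).symm } }
  let s (s : Cocone Z) : Cocone Y :=
    { pt := s.pt
      ι :=
        { app := fun j ↦ (d j).i ≫ s.ι.app j
          naturality := fun i j f ↦ by
            have := s.w f
            rw [← Category.assoc, ← hZ, Category.assoc]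
            exact (congr_arg ((d i).i ≫ ·) this).trans (Category.comp_id _).symm } }
  -- The maps `Y j ⟶ Z j` are epimorphisms, so the factorizations checked on `Y` already hold on
  -- `Z`.
  have hcZ : IsColimit cZ :=
    { desc := fun t ↦ hc.desc (s t)
      fac := fun t j ↦ by
        rw [← cancel_epi (d j).i, ← Category.assoc]
        exact (congr_arg (· ≫ _) (hd j)).trans (hc.fac (s t) j)
      uniq := fun t m hm ↦ hc.uniq (s t) m (fun j ↦ by
        rw [← hd, Category.assoc]
        exact congr_arg ((d j).i ≫ ·) (hm j)) }
  obtain ⟨hTZ⟩ := hT Z cZ hcZ (fun j ↦ (d j).hp)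
  have hrZ {i j : J} (f : i ⟶ j) (g : Order.succ i ⟶ Order.succ j) :
      l f ≫ r j = r i ≫ Y.map g := by
    rw [← cancel_epi (d i).i, reassoc_of% (hZ f), hr, reassoc_of% (hr i), ← Y.map_comp,
      ← Y.map_comp]
    rfl
  -- Restriction along `T.map (r j)` carries cocones on `Y ⋙ T` to cocones on `Z ⋙ T`, where the
  -- universal property is available.
  let t (t : Cocone (Y ⋙ T)) : Cocone (Z ⋙ T) :=
    { pt := t.pt
      ι :=
        { app := fun j ↦ T.map (r j) ≫ t.ι.app (Order.succ j)
          naturality := fun i j f ↦ by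
            have h := t.w (homOfLE (Order.succ_le_succ (leOfHom f)))
            dsimp at h ⊢
            rw [Category.comp_id, ← T.map_comp_assoc,
              hrZ f (homOfLE (Order.succ_le_succ (leOfHom f))), T.map_comp_assoc, h] } }
  exact ⟨{
    desc := fun u ↦ hTZ.desc (t u)
    fac := fun u j ↦ by
      have h₁ := hTZ.fac (t u) j
      have h₂ := u.w (homOfLE (Order.le_succ j))
      dsimp [t, cZ] at h₁ h₂ ⊢
      rw [← hd, T.map_comp_assoc, h₁, ← T.map_comp_assoc, hr, h₂]
    uniq := fun u m hm ↦ hTZ.uniq (t u) m (fun j ↦ by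
      have h := hm (Order.succ j)
      dsimp [t, cZ] at h ⊢
      rw [← hrn, T.map_comp_assoc, h]) }⟩

end Interleaving

/-! ### Convergence and free algebras -/

namespace PointedStage

variable {D : Type u} [Category.{v} D] {T : D ⥤ D} (η : 𝟭 D ⟶ T)
  {J : Type w} [LinearOrder J] [SuccOrder J]

/-- Because `T` preserves the colimit of the left objects, left and right objects of the colimit are
computed separately. The diagonals `z j` then induce a map from right to left which inverts the
point. -/
theorem isAlgebra_of_isColimit [HasColimitsOfShape J D] [HasPushouts D]
    {F : J ⥤ Comma T (𝟭 D)} {c : Cocone F} (hc : IsColimit c)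
    [PreservesColimit (F ⋙ Comma.fst T (𝟭 D)) T]
    (z : ∀ j, (F.obj j).right ⟶ (F.obj (Order.succ j)).left)
    (hz : ∀ j, point η _ ≫ z j = (F.map (homOfLE (Order.le_succ j))).left)
    (hz' : ∀ j, z j ≫ point η _ = (F.map (homOfLE (Order.le_succ j))).right) :
    isAlgebra η c.pt := by
  have h₁ := isColimitOfPreserves (Comma.fst T (𝟭 D)) hc
  have : PreservesColimit F (Comma.snd T (𝟭 D)) :=
    preservesColimit_of_preserves_colimit_cocone
      (Comma.coconeOfPreservesIsColimit F (colimit.isColimit _) (colimit.isColimit _))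
      (IsColimit.ofIsoColimit (colimit.isColimit (F ⋙ Comma.snd T (𝟭 D)))
        (Cocone.ext (Iso.refl _) (fun j ↦ by exact Category.comp_id _)))
  have h₂ := isColimitOfPreserves (Comma.snd T (𝟭 D)) hc
  have hw {i j : J} (f : i ⟶ j) : (F.map f).left ≫ (c.ι.app j).left = (c.ι.app i).left :=
    congr_arg CommaMorphism.left (c.w f)
  have hw' {i j : J} (f : i ⟶ j) : (F.map f).right ≫ (c.ι.app j).right = (c.ι.app i).right :=
    congr_arg CommaMorphism.right (c.w f)
  let s : Cocone (F ⋙ Comma.snd T (𝟭 D)) :=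
    { pt := c.pt.left
      ι :=
        { app := fun j ↦ z j ≫ (c.ι.app (Order.succ j)).left
          naturality := fun i j f ↦ by
            refine Eq.trans ?_ (Category.comp_id _).symm
            -- For `i < j` the transition map passes through stage `succ i`, where it can be
            -- rewritten with `z i`; the identity must be treated apart.
            obtain rfl | hij := (leOfHom f).eq_or_lt
            · obtain rfl : f = 𝟙 _ := rfl
              exact (congr_arg (· ≫ _) ((F ⋙ Comma.snd T (𝟭 D)).map_id i)).trans
                (Category.id_comp _)
            · let g : Order.succ i ⟶ j := homOfLE (Order.succ_le_of_lt hij)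
              have hf : (F.map f).right = z i ≫ point η _ ≫ (F.map g).right := by
                rw [← Category.assoc, hz', ← Comma.comp_right, ← F.map_comp]
                rfl
              change (F.map f).right ≫ z j ≫ _ = _
              rw [hf, Category.assoc, Category.assoc, ← point_naturality_assoc,
                reassoc_of% (hz j), hw, hw] } }
  have hs (j : J) : (c.ι.app j).right ≫ h₂.desc s = z j ≫ (c.ι.app (Order.succ j)).left :=
    h₂.fac s j
  have hp (j : J) : (c.ι.app j).left ≫ point η c.pt = point η (F.obj j) ≫ (c.ι.app j).right :=
    point_naturality η (p := F.obj j) (q := c.pt) (c.ι.app j)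
  refine ⟨h₂.desc s, ?_, ?_⟩
  · refine h₁.hom_ext (fun j ↦ ?_)
    change (c.ι.app j).left ≫ _ ≫ _ = (c.ι.app j).left ≫ _
    rw [reassoc_of% (hp j), hs, reassoc_of% (hz j), hw]
    exact (Category.comp_id _).symm
  · refine h₂.hom_ext (fun j ↦ ?_)
    change (c.ι.app j).right ≫ _ ≫ _ = (c.ι.app j).right ≫ _
    rw [reassoc_of% (hs j), hp, reassoc_of% (hz' j), hw']
    exact (Category.comp_id _).symm

/-- The free algebra sequence, with stabilization of images interpolated, converges. -/
theorem exists_isLocal_isAlgebra [HasColimits D] (hT : SmallnessCondition T)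
    (p : Comma T (𝟭 D)) :
    ∃ (q : Comma T (𝟭 D)) (f : p ⟶ q), (isAlgebra η).isLocal f ∧ isAlgebra η q := by
  obtain ⟨E, M, α, hEM, hE, hα, hM⟩ := hT
  have := hEM.wfs
  choose s f hf using exists_isStep η hE
  let S : SmallObject.SuccStruct (Comma T (𝟭 D)) := ⟨p, s, f⟩
  have : Nonempty α.ord.ToType := by simpa using hα.ne_zero
  let _ := WellFoundedLT.toOrderBot α.ord.ToType
  -- A regular cardinal is infinite, so its initial ordinal is a limit and a genuine step leaves
  -- every stage.
  have : NoMaxOrder α.ord.ToType := Cardinal.noMaxOrder hα.aleph0_le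
  let _ := SuccOrder.ofLinearWellFoundedLT α.ord.ToType
  have : HasColimitsOfSize.{v, v} (Comma T (𝟭 D)) := ⟨fun _ _ ↦ inferInstance⟩
  have tc := S.transfiniteCompositionOfShapeιIteration α.ord.ToType
  have hstep : S.prop ≤ fun _ _ f ↦ IsStep η E f := by
    rintro _ _ _ ⟨_⟩
    exact hf _
  have hloc : S.prop ≤ (isAlgebra η).isLocal := fun _ _ f h ↦ (hstep _ h).isLocal
  refine ⟨_, S.ιIteration α.ord.ToType, (tc.ofLE hloc).mem.elim fun h ↦
    MorphismProperty.transfiniteCompositionsOfShape_le _ _ _ ⟨h⟩, ?_⟩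
  have hmap (j : α.ord.ToType) : IsStep η E (tc.F.map (homOfLE (Order.le_succ j))) :=
    hstep _ (tc.map_mem j (not_isMax j))
  have hincl (j : α.ord.ToType) : (isAlgebra η).isLocal (tc.incl.app j) :=
    (tc.ofLE hloc).mem_incl_app j
  have hc := isColimitOfPreserves (Comma.fst T (𝟭 D)) tc.isColimit
  obtain ⟨hTc⟩ := nonempty_isColimit_mapCocone_of_stable (E := E) (M := M)
    (fun _ _ e he ↦ hE.epi (M := M) e he) (T := T) (fun F c ↦ hM F c) hc (by
      intro j B e n he hen
      -- The inclusion of stage `succ j` into the colimit is itself local, so stability applies to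
      -- `E`-images in the colimit.
      refine (hmap j).stable (tc.incl.app (Order.succ j)) (hincl _) e n he (hen.trans ?_)
      have := tc.incl.naturality (homOfLE (Order.le_succ j))
      exact congr_arg CommaMorphism.left (this.trans (Category.comp_id _)).symm)
  have := preservesColimit_of_preserves_colimit_cocone hc hTc
  choose z hz using fun j ↦ (hmap j).exists_section
  exact isAlgebra_of_isColimit η (F := tc.F) (c := ⟨_, tc.incl⟩) tc.isColimit z (fun j ↦ (hz j).1) (fun j ↦ (hz j).2)

/-- Free algebras for a pointed endofunctor satisfying the smallness condition. -/
theorem exists_free_algebra [HasColimits D] (hT : SmallnessCondition T) (X : D) :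
    ∃ (A : D) (a : T.obj A ⟶ A) (_ : η.app A ≫ a = 𝟙 A) (u : X ⟶ A),
      ∀ ⦃B : D⦄ (b : T.obj B ⟶ B), η.app B ≫ b = 𝟙 B → ∀ g : X ⟶ B,
        ∃! h : A ⟶ B, T.map h ≫ b = a ≫ h ∧ u ≫ h = g := by
  -- A map from `𝟙 (T X)` to an algebra `b` amounts to a map `g : X ⟶ B`: the right component must
  -- be `T.map g ≫ b`.
  let p : Comma T (𝟭 D) := { left := X, right := T.obj X, hom := 𝟙 (T.obj X) }
  obtain ⟨q, f, hf, hq⟩ := exists_isLocal_isAlgebra η hT p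
  have : IsIso (point η q) := hq
  refine ⟨q.left, q.hom ≫ inv (point η q), ?_, f.left, ?_⟩
  · exact (Category.assoc _ _ _).symm.trans (IsIso.hom_inv_id (point η q))
  intro B b hb g
  let B' : Comma T (𝟭 D) := { left := B, right := B, hom := b }
  have hB : point η B' = 𝟙 B := hb
  have hB' : isAlgebra η B' := by
    change IsIso (point η B')
    rw [hB]
    exact inferInstanceAs (IsIso (𝟙 B))
  have hpt (m : q ⟶ B') : m.left = point η q ≫ m.right := by
    rw [← point_naturality, hB]
    exact (Category.comp_id _).symm
  have hext {m m' : p ⟶ B'} (h : m.left = m'.left) : m = m' := by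
    ext
    · exact h
    · have h₁ := map_hom m
      have h₂ := map_hom m'
      rw [h] at h₁
      exact (Category.id_comp _).symm.trans ((h₁.symm.trans h₂).trans (Category.id_comp _))
  let m : p ⟶ B' := { left := g, right := T.map g ≫ b, w := (Category.id_comp _).symm }
  obtain ⟨m', hm'⟩ := (hf B' hB').2 m
  refine ⟨m'.left, ⟨?_, congr_arg CommaMorphism.left hm'⟩, ?_⟩
  · rw [Category.assoc, hpt m', IsIso.inv_hom_id_assoc, ← hpt]
    exact map_hom m'
  · rintro h ⟨hh, hg⟩
    let m'' : q ⟶ B' :=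
      { left := h
        right := inv (point η q) ≫ h
        w := hh.trans (Category.assoc _ _ _) }
    have : m'' = m' := (hf B' hB').1 (by
      apply hext
      exact hg.trans (congr_arg CommaMorphism.left hm').symm)
    exact congr_arg CommaMorphism.left this

end PointedStage

variable {C : Type u} [Category.{v} C] {I : Type w} [Category.{w'} I] {ι : I ⥤ Arrow C}

/-! ### Base change and vertical composition of lifting functions -/

namespace RightLiftingFunction

/-- Compatibility of a square with chosen lifts. -/
def IsHom {f g : Arrow C} (φ : RightLiftingFunction ι f) (ψ : RightLiftingFunction ι g)
    (s : f ⟶ g) : Prop :=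
  ∀ j (σ : ι.obj j ⟶ f), φ.lift j σ ≫ s.left = ψ.lift j (σ ≫ s)

lemma isHom_id {f : Arrow C} (φ : RightLiftingFunction ι f) : φ.IsHom φ (𝟙 f) := fun j σ ↦ by
  rw [Category.comp_id, Arrow.id_left, Category.comp_id]

lemma IsHom.comp {f g h : Arrow C} {φ : RightLiftingFunction ι f} {ψ : RightLiftingFunction ι g}
    {χ : RightLiftingFunction ι h} {s : f ⟶ g} {t : g ⟶ h} (hs : φ.IsHom ψ s)
    (ht : ψ.IsHom χ t) : φ.IsHom χ (s ≫ t) := fun j σ ↦ by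
  rw [Arrow.comp_left, ← Category.assoc, hs, ht, Category.assoc]

/-- The lifting function induced on a retract. -/
def ofRetract {f g : Arrow C} (φ : RightLiftingFunction ι f) (i : g ⟶ f) (r : f ⟶ g)
    (hir : i ≫ r = 𝟙 g) : RightLiftingFunction ι g where
  lift j σ := φ.lift j (σ ≫ i) ≫ r.left
  fac_left j σ := by
    rw [← Category.assoc, φ.fac_left, ← Arrow.comp_left, Category.assoc, hir, Category.comp_id]
  fac_right j σ := by
    rw [Category.assoc, Arrow.w, ← Category.assoc, φ.fac_right, ← Arrow.comp_right,
      Category.assoc, hir, Category.comp_id]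
  natural m σ := by rw [Category.assoc, φ.natural, Category.assoc]

/-- Lifting functions pull back along base change. -/
noncomputable def baseChange [HasPullbacks C] {f : Arrow C} (φ : RightLiftingFunction ι f)
    {B : C} (c : B ⟶ f.right) : RightLiftingFunction ι (Arrow.mk (pullback.snd f.hom c)) where
  lift j σ := pullback.lift
    (φ.lift j (σ ≫ Arrow.homMk (pullback.fst f.hom c) c pullback.condition)) σ.right
    (by rw [φ.fac_right]; rfl)
  fac_left j σ := by
    apply pullback.hom_ext
    · rw [Category.assoc, pullback.lift_fst, φ.fac_left]
      rfl
    · rw [Category.assoc, pullback.lift_snd]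
      exact (Arrow.w σ).symm
  fac_right j σ := pullback.lift_snd _ _ _
  natural m σ := by
    apply pullback.hom_ext
    · rw [pullback.lift_fst, Category.assoc, Category.assoc, pullback.lift_fst, φ.natural]
    · rw [pullback.lift_snd, Category.assoc, pullback.lift_snd]
      rfl

lemma isHom_baseChange [HasPullbacks C] {f : Arrow C} (φ : RightLiftingFunction ι f)
    {B : C} (c : B ⟶ f.right) : (φ.baseChange c).IsHom φ
      (Arrow.homMk (pullback.fst f.hom c) c pullback.condition) :=
  fun _ _ ↦ pullback.lift_fst _ _ _

section Comp

variable {X Y Z : C} {a : X ⟶ Y} {b : Y ⟶ Z}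

/-- The lower part of a lifting problem against a composite. -/
def lowerSquare {k : Arrow C} (σ : k ⟶ Arrow.mk (a ≫ b)) : k ⟶ Arrow.mk b :=
  Arrow.homMk (σ.left ≫ a) σ.right ((Category.assoc _ _ _).trans (Arrow.w σ))

/-- The upper part of a lifting problem against a composite, given a solution of the lower part. -/
def upperSquare (ψ : RightLiftingFunction ι (Arrow.mk b)) {j : I}
    (σ : ι.obj j ⟶ Arrow.mk (a ≫ b)) : ι.obj j ⟶ Arrow.mk a :=
  Arrow.homMk σ.left (ψ.lift j (lowerSquare σ)) (ψ.fac_left j (lowerSquare σ)).symm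

/-- The vertical composition of lifting functions. -/
def comp (φ : RightLiftingFunction ι (Arrow.mk a)) (ψ : RightLiftingFunction ι (Arrow.mk b)) :
    RightLiftingFunction ι (Arrow.mk (a ≫ b)) where
  lift j σ := φ.lift j (upperSquare ψ σ)
  fac_left j σ := φ.fac_left j _
  fac_right j σ := (Category.assoc _ _ _).symm.trans
    ((congr_arg (· ≫ b) (φ.fac_right j _)).trans (ψ.fac_right j _))
  natural {j' j} m σ := by
    rw [← φ.natural]
    refine congr_arg (φ.lift j') (Arrow.hom_ext _ _ rfl ?_)
    refine Eq.trans ?_ (ψ.natural m _)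
    exact congr_arg (ψ.lift j') (Arrow.hom_ext _ _ (Category.assoc _ _ _) rfl)

lemma isHom_comp_map {X' Y' Z' : C} {a' : X' ⟶ Y'} {b' : Y' ⟶ Z'}
    {φ : RightLiftingFunction ι (Arrow.mk a)} {ψ : RightLiftingFunction ι (Arrow.mk b)}
    {φ' : RightLiftingFunction ι (Arrow.mk a')} {ψ' : RightLiftingFunction ι (Arrow.mk b')}
    {x : X ⟶ X'} {y : Y ⟶ Y'} {z : Z ⟶ Z'} {w₁ : x ≫ a' = a ≫ y} {w₂ : y ≫ b' = b ≫ z}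
    (h₁ : φ.IsHom φ' (Arrow.homMk x y w₁)) (h₂ : ψ.IsHom ψ' (Arrow.homMk y z w₂))
    (w : x ≫ a' ≫ b' = (a ≫ b) ≫ z) :
    (φ.comp ψ).IsHom (φ'.comp ψ') (Arrow.homMk x z w) := fun j σ ↦
  (h₁ j (upperSquare ψ σ)).trans (congr_arg (φ'.lift j) (Arrow.hom_ext _ _ rfl
    ((h₂ j (lowerSquare σ)).trans (congr_arg (ψ'.lift j) (Arrow.hom_ext _ _
      ((Category.assoc _ _ _).trans
        ((congr_arg (σ.left ≫ ·) w₁.symm).trans (Category.assoc _ _ _).symm)) rfl)))))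

/-- The lower lift followed by `b` returns the bottom of the original square, so the `φ`-lift solves
the right problem. This yields the counit law `d_map_counit`. -/
lemma isHom_comp_desc {X' : C} {b' : X' ⟶ Z}
    {φ : RightLiftingFunction ι (Arrow.mk a)} (ψ : RightLiftingFunction ι (Arrow.mk b))
    {χ : RightLiftingFunction ι (Arrow.mk b')} {x : X ⟶ X'} {w₁ : x ≫ b' = a ≫ b}
    (h : φ.IsHom χ (Arrow.homMk x b w₁)) (w : x ≫ b' = (a ≫ b) ≫ 𝟙 Z) :
    (φ.comp ψ).IsHom χ (Arrow.homMk x (𝟙 Z) w) := fun j σ ↦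
  (h j (upperSquare ψ σ)).trans (congr_arg (χ.lift j) (Arrow.hom_ext _ _ rfl
    ((ψ.fac_right j _).trans (Category.comp_id _).symm)))

lemma isHom_comp_right (φ : RightLiftingFunction ι (Arrow.mk a))
    (ψ : RightLiftingFunction ι (Arrow.mk b)) (w : a ≫ b = (a ≫ b) ≫ 𝟙 Z) :
    (φ.comp ψ).IsHom ψ (Arrow.homMk a (𝟙 Z) w) := fun j σ ↦
  (φ.fac_right j (upperSquare ψ σ)).trans (congr_arg (ψ.lift j) (Arrow.hom_ext _ _ rfl
    (Category.comp_id _).symm))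

lemma isHom_comp_assoc {W : C} {c : Z ⟶ W} (φ : RightLiftingFunction ι (Arrow.mk a))
    (ψ : RightLiftingFunction ι (Arrow.mk b)) (χ : RightLiftingFunction ι (Arrow.mk c))
    (w : 𝟙 X ≫ a ≫ b ≫ c = ((a ≫ b) ≫ c) ≫ 𝟙 W) :
    ((φ.comp ψ).comp χ).IsHom (φ.comp (ψ.comp χ)) (Arrow.homMk (𝟙 X) (𝟙 W) w) := fun j σ ↦ by
  have h : σ.left ≫ a = (σ.left ≫ 𝟙 X) ≫ a :=
    (congr_arg (· ≫ a) (Category.comp_id _)).symm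
  exact (Category.comp_id _).trans (congr_arg (φ.lift j) (Arrow.hom_ext _ _
    (Category.comp_id _).symm (congr_arg (ψ.lift j) (Arrow.hom_ext _ _ h
      (congr_arg (χ.lift j) (Arrow.hom_ext _ _
        ((Category.assoc _ _ _).symm.trans (congr_arg (· ≫ b) h))
        (Category.comp_id _).symm))))))

end Comp

end RightLiftingFunction

/-! ### Free objects of `I^⧄` and the functorial factorization -/

section Free

/-- Free objects of `I^⧄` exist under the hypotheses of the algebraic small object argument. -/
theorem exists_free_rightLifting [HasColimits C] (R : PointedEndofunctorOverCod C)
    (e : IsoOver (RightLifting.forget ι) (PointedEndofunctorOverCod.Algebra.forget R))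
    (hR : SmallnessCondition R.R) (f : Arrow C) :
    ∃ (X : RightLifting ι) (u : f ⟶ X.arrow), ∀ (Y : RightLifting ι) (g : f ⟶ Y.arrow),
      ∃! h : X ⟶ Y, u ≫ h.f = g := by
  have h₁ : (PointedEndofunctorOverCod.Algebra.forget R).IsRightAdjoint := by
    have (X : Arrow C) :
        HasInitial (StructuredArrow X (PointedEndofunctorOverCod.Algebra.forget R)) := by
      obtain ⟨A, a, ha, u, hu⟩ := PointedStage.exists_free_algebra R.η hR X
      let A' : R.Algebra := ⟨A, a, ha⟩
      choose h hh hh' using fun (S : StructuredArrow X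
        (PointedEndofunctorOverCod.Algebra.forget R)) ↦ hu S.right.a S.right.unit S.hom
      have hc (S : StructuredArrow X (PointedEndofunctorOverCod.Algebra.forget R)) :
          R.R.map (h S) ≫ S.right.a = a ≫ h S :=
        (hh S).1
      let l (S : StructuredArrow X (PointedEndofunctorOverCod.Algebra.forget R)) :
          A' ⟶ S.right := ⟨h S, hc S⟩
      let T : StructuredArrow X (PointedEndofunctorOverCod.Algebra.forget R) :=
        StructuredArrow.mk (Y := A') u
      exact (IsInitial.ofUniqueHom (X := T) (fun S ↦ StructuredArrow.homMk (l S) (hh S).2)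
        (fun S m ↦ by
          ext
          apply PointedEndofunctorOverCod.Algebra.Hom.ext
          exact hh' S _ ⟨m.right.comm, StructuredArrow.w m⟩)).hasInitial
    exact isRightAdjointOfStructuredArrowInitials _
  -- An isomorphism of categories is an equivalence, so right adjointness passes from the algebras
  -- to `RightLifting.forget ι`.
  have h₂ : e.functor.IsRightAdjoint :=
    (CategoryTheory.Equivalence.mk e.functor e.inverse (eqToIso e.functor_comp_inverse.symm)
      (eqToIso e.inverse_comp_functor)).isRightAdjoint_functor
  have h₃ : (RightLifting.forget ι).IsRightAdjoint := by
    rw [← e.functor_comp]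
    infer_instance
  let adj := Adjunction.ofIsRightAdjoint (RightLifting.forget ι)
  refine ⟨_, adj.unit.app f, fun Y g ↦ ⟨(adj.homEquiv _ _).symm g, ?_, fun h hh ↦ ?_⟩⟩
  · exact (adj.homEquiv_unit _ _ _).symm.trans ((adj.homEquiv _ _).apply_symm_apply g)
  · exact (Equiv.eq_symm_apply _).2 ((adj.homEquiv_unit _ _ _).trans hh)

/-- A functorial factorization whose right factors are the free objects of `I^⧄`. -/
structure FreeFactorization (ι : I ⥤ Arrow C) where
  /-- the functorial factorization -/
  F : FunctorialFactorization C
  /-- the chosen lifts of the right factors -/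
  φ : ∀ f : Arrow C, RightLiftingFunction ι (F.R.obj f)
  isHom_map : ∀ {f g : Arrow C} (s : f ⟶ g), (φ f).IsHom (φ g) (F.R.map s)
  exists_desc : ∀ {f g : Arrow C} (ψ : RightLiftingFunction ι g) (s : f ⟶ g),
    ∃ t : F.R.obj f ⟶ g, (φ f).IsHom ψ t ∧ F.η.app f ≫ t = s
  hom_ext : ∀ {f g : Arrow C} {ψ : RightLiftingFunction ι g} {t t' : F.R.obj f ⟶ g},
    (φ f).IsHom ψ t → (φ f).IsHom ψ t' → F.η.app f ≫ t = F.η.app f ≫ t' → t = t'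

/-- Pulling the free object back along `u.right` gives an object over `f.right`, through which `u`
factors with identity codomain component. Freeness provides a map back, whose codomain component
inverts `u.right`. -/
theorem isIso_right_of_free [HasPullbacks C] {f : Arrow C} {X : RightLifting ι}
    (u : f ⟶ X.arrow)
    (hu : ∀ (Y : RightLifting ι) (g : f ⟶ Y.arrow), ∃! h : X ⟶ Y, u ≫ h.f = g) :
    IsIso u.right := by
  let P : RightLifting ι := ⟨_, X.φ.baseChange u.right⟩
  let π : P ⟶ X := ⟨_, X.φ.isHom_baseChange u.right⟩
  let g : f ⟶ P.arrow := Arrow.homMk (pullback.lift u.left f.hom (Arrow.w u)) (𝟙 _)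
    ((pullback.lift_snd _ _ _).trans (Category.comp_id _).symm)
  obtain ⟨h, hh, -⟩ := hu P g
  have hπ : g ≫ π.f = u := by
    ext
    · exact pullback.lift_fst _ _ _
    · exact Category.id_comp _
  have h₁ : h ≫ π = 𝟙 X := (hu X u).unique
    ((Category.assoc _ _ _).symm.trans ((congr_arg (· ≫ π.f) hh).trans hπ)) (Category.comp_id _)
  refine ⟨h.f.right, ?_, ?_⟩
  · exact congr_arg Arrow.Hom.right hh
  · exact congr_arg (fun m : X ⟶ X ↦ Arrow.Hom.right m.f) h₁

theorem nonempty_freeFactorization [HasPullbacks C]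
    (H : ∀ f : Arrow C, ∃ (X : RightLifting ι) (u : f ⟶ X.arrow),
      ∀ (Y : RightLifting ι) (g : f ⟶ Y.arrow), ∃! h : X ⟶ Y, u ≫ h.f = g) :
    Nonempty (FreeFactorization ι) := by
  choose X u hu using H
  have hiso (f) : IsIso (u f).right := isIso_right_of_free (u f) (hu f)
  choose d hd using fun {f g : Arrow C} (s : f ⟶ g) ↦ (hu f (X g) (s ≫ u g)).exists
  have hext {f : Arrow C} {Y : RightLifting ι} {h h' : X f ⟶ Y} (hh : u f ≫ h.f = u f ≫ h'.f) :
      h = h' := (hu f Y _).unique hh rfl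
  have hdl {f g : Arrow C} (s : f ⟶ g) : (u f).left ≫ (d s).f.left = s.left ≫ (u g).left :=
    congr_arg Arrow.Hom.left (hd s)
  have hdr {f g : Arrow C} (s : f ⟶ g) : (u f).right ≫ (d s).f.right = s.right ≫ (u g).right :=
    congr_arg Arrow.Hom.right (hd s)
  have hd_id (f : Arrow C) : d (𝟙 f) = 𝟙 _ := hext (by
    rw [hd, Category.id_comp]; exact (Category.comp_id _).symm)
  have hd_comp {f g h : Arrow C} (s : f ⟶ g) (t : g ⟶ h) : d (s ≫ t) = d s ≫ d t := hext (by
    change _ = u f ≫ (d s).f ≫ (d t).f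
    rw [hd, reassoc_of% (hd s), hd, Category.assoc])
  -- Correcting by the inverse of `(u f).right` makes the codomain of the right factor equal to
  -- `f.right` on the nose; lifting functions follow along the isomorphisms `α` and `β` below.
  let p (f : Arrow C) : (X f).arrow.left ⟶ f.right := (X f).arrow.hom ≫ inv (u f).right
  have hp {f g : Arrow C} (s : f ⟶ g) : (d s).f.left ≫ p g = p f ≫ s.right := by
    have : (d s).f.right ≫ inv (u g).right = inv (u f).right ≫ s.right := by
      rw [IsIso.comp_inv_eq, Category.assoc, ← hdr, IsIso.inv_hom_id_assoc]
    simp only [p, Category.assoc, ← this]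
    rw [← Category.assoc, Arrow.w, Category.assoc]
  let F : FunctorialFactorization C :=
    { Z :=
        { obj := fun f ↦ (X f).arrow.left
          map := fun s ↦ (d s).f.left
          map_id := fun f ↦ by rw [hd_id]; rfl
          map_comp := fun s t ↦ by rw [hd_comp]; rfl }
      i :=
        { app := fun f ↦ (u f).left
          naturality := fun f g s ↦ (hdl s).symm }
      p :=
        { app := p
          naturality := fun f g s ↦ hp s }
      fac := by
        ext f
        change (u f).left ≫ (X f).arrow.hom ≫ inv (u f).right = f.hom
        rw [← Category.assoc, Arrow.w, Category.assoc, IsIso.hom_inv_id, Category.comp_id]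
      hi := fun _ ↦ trivial
      hp := fun _ ↦ trivial }
  let v (f : Arrow C) : (X f).arrow.right ⟶ f.right := inv (u f).right
  have huv (f : Arrow C) : (u f).right ≫ v f = 𝟙 f.right := IsIso.hom_inv_id _
  have hvu (f : Arrow C) : v f ≫ (u f).right = 𝟙 (X f).arrow.right := IsIso.inv_hom_id _
  let α (f : Arrow C) : (X f).arrow ⟶ F.R.obj f :=
    Arrow.homMk (𝟙 _) (v f) (Category.id_comp _)
  let β (f : Arrow C) : F.R.obj f ⟶ (X f).arrow :=
    Arrow.homMk (𝟙 _) (u f).right (by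
      refine (Category.id_comp _).trans ?_
      change _ = ((X f).arrow.hom ≫ inv (u f).right) ≫ _
      rw [Category.assoc, IsIso.inv_hom_id, Category.comp_id])
  have hβα (f) : β f ≫ α f = 𝟙 _ := by
    ext
    · exact Category.id_comp _
    · exact huv f
  have hαβ (f) : α f ≫ β f = 𝟙 _ := by
    ext
    · exact Category.id_comp _
    · exact hvu f
  have hηβ (f) : F.η.app f ≫ β f = u f := by
    ext
    · exact Category.comp_id _
    · exact Category.id_comp _
  let φ (f : Arrow C) : RightLiftingFunction ι (F.R.obj f) :=
    (X f).φ.ofRetract (β f) (α f) (hβα f)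
  have hβ (f) : (φ f).IsHom (X f).φ (β f) := fun j σ ↦
    (Category.assoc _ _ _).trans ((congr_arg _ (Category.id_comp (𝟙 _))).trans (Category.comp_id _))
  have hα (f) : (X f).φ.IsHom (φ f) (α f) := fun j σ ↦ by
    change _ = (X f).φ.lift j ((σ ≫ α f) ≫ β f) ≫ _
    rw [Category.assoc, hαβ, Category.comp_id]
  refine ⟨⟨F, φ, ?_, ?_, ?_⟩⟩
  · intro f g s
    have : F.R.map s = β f ≫ (d s).f ≫ α g := by
      ext
      · exact ((Category.id_comp _).trans (Category.comp_id _)).symm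
      · change s.right = (u f).right ≫ (d s).f.right ≫ inv (u g).right
        rw [← Category.assoc, hdr, Category.assoc, IsIso.hom_inv_id, Category.comp_id]
    rw [this]
    exact (hβ f).comp (RightLiftingFunction.IsHom.comp (d s).comm (hα g))
  · intro f g ψ s
    obtain ⟨h, hh, -⟩ := hu f ⟨g, ψ⟩ s
    refine ⟨β f ≫ h.f, (hβ f).comp h.comm, ?_⟩
    rw [← Category.assoc, hηβ, hh]
  · intro f g ψ t t' ht ht' h
    have : (⟨α f ≫ t, (hα f).comp ht⟩ : X f ⟶ ⟨g, ψ⟩) = ⟨α f ≫ t', (hα f).comp ht'⟩ := hext (by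
      change u f ≫ α f ≫ t = u f ≫ α f ≫ t'
      rw [← hηβ]
      simp only [Category.assoc]
      rw [reassoc_of% (hβα f), reassoc_of% (hβα f), h])
    have h' : α f ≫ t = α f ≫ t' := congr_arg RightLifting.Hom.f this
    rw [← Category.id_comp t, ← Category.id_comp t', ← hβα, Category.assoc, Category.assoc, h']

end Free

/-! ### Monad, comonad and distributive law -/

namespace FreeFactorization

variable {C : Type u} [Category.{v} C] {I : Type w} [Category.{w'} I] {ι : I ⥤ Arrow C}
  (G : FreeFactorization ι)

/-- The middle object of the factorization. -/
abbrev Z (f : Arrow C) : C := G.F.Z.obj f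

/-- The left factor. -/
abbrev i (f : Arrow C) : f.left ⟶ G.Z f := G.F.i.app f

/-- The right factor. -/
abbrev p (f : Arrow C) : G.Z f ⟶ f.right := G.F.p.app f

/-- The left factor, as an object of the arrow category. -/
abbrev L (f : Arrow C) : Arrow C := Arrow.mk (G.i f)

/-- The right factor, as an object of the arrow category. -/
abbrev R (f : Arrow C) : Arrow C := Arrow.mk (G.p f)

/-- The action of the factorization on squares. -/
abbrev map {f g : Arrow C} (s : f ⟶ g) : G.Z f ⟶ G.Z g := G.F.Z.map s

/-- The lifting function of the right factor. -/
abbrev lifting (f : Arrow C) : RightLiftingFunction ι (G.R f) := G.φ f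

lemma i_p (f : Arrow C) : G.i f ≫ G.p f = f.hom := G.F.fac_app' f

lemma i_p_assoc (f : Arrow C) {X : C} (k : f.right ⟶ X) :
    G.i f ≫ G.p f ≫ k = f.hom ≫ k := by
  rw [← Category.assoc, i_p]

lemma i_map {f g : Arrow C} (s : f ⟶ g) : G.i f ≫ G.map s = s.left ≫ G.i g :=
  (G.F.i.naturality s).symm

lemma i_map_assoc {f g : Arrow C} (s : f ⟶ g) {X : C} (k : G.Z g ⟶ X) :
    G.i f ≫ G.map s ≫ k = s.left ≫ G.i g ≫ k := by
  rw [← Category.assoc, i_map, Category.assoc]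

lemma map_p {f g : Arrow C} (s : f ⟶ g) : G.map s ≫ G.p g = G.p f ≫ s.right :=
  G.F.p.naturality s

lemma map_p_assoc {f g : Arrow C} (s : f ⟶ g) {X : C} (k : g.right ⟶ X) :
    G.map s ≫ G.p g ≫ k = G.p f ≫ s.right ≫ k := by
  rw [← Category.assoc, map_p, Category.assoc]

lemma map_comp {f g h : Arrow C} (s : f ⟶ g) (t : g ⟶ h) :
    G.map (s ≫ t) = G.map s ≫ G.map t := G.F.Z.map_comp s t

lemma map_comp_assoc {f g h : Arrow C} (s : f ⟶ g) (t : g ⟶ h) {X : C} (k : G.Z h ⟶ X) :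
    G.map (s ≫ t) ≫ k = G.map s ≫ G.map t ≫ k := by
  rw [map_comp, Category.assoc]

/-- The functoriality of the left factor. -/
abbrev mapL {f g : Arrow C} (s : f ⟶ g) : G.L f ⟶ G.L g :=
  Arrow.homMk s.left (G.map s) (G.i_map s).symm

/-- The functoriality of the right factor. -/
abbrev mapR {f g : Arrow C} (s : f ⟶ g) : G.R f ⟶ G.R g :=
  Arrow.homMk (G.map s) s.right (G.map_p s)

lemma isHom_mapR {f g : Arrow C} (s : f ⟶ g) : (G.lifting f).IsHom (G.lifting g) (G.mapR s) :=
  G.isHom_map s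

/-- The unit has identity codomain component, so the bottom of the extension can be prescribed
exactly. The multiplication, the comultiplication and the algebra structures all come from here. -/
lemma exists_extension {f g : Arrow C} (ψ : RightLiftingFunction ι g) (a : f.left ⟶ g.left)
    (b : f.right ⟶ g.right) (w : a ≫ g.hom = f.hom ≫ b) :
    ∃ (x : G.Z f ⟶ g.left) (h : x ≫ g.hom = G.p f ≫ b),
      (G.lifting f).IsHom ψ (Arrow.homMk x b h) ∧ G.i f ≫ x = a := by
  obtain ⟨t, ht, ht'⟩ := G.exists_desc ψ (Arrow.homMk a b w)
  have hr : t.right = b := (Category.id_comp _).symm.trans (congr_arg Arrow.Hom.right ht')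
  have hl : G.i f ≫ t.left = a := congr_arg Arrow.Hom.left ht'
  subst hr
  exact ⟨t.left, Arrow.w t, ht, hl⟩

section Multiplication

/-- The multiplication, as a map of `C`. -/
noncomputable def m (f : Arrow C) : G.Z (G.R f) ⟶ G.Z f :=
  (G.exists_extension (f := G.R f) (G.lifting f) (𝟙 _) (𝟙 _)
    ((Category.id_comp _).trans (Category.comp_id _).symm)).choose

lemma m_p' (f : Arrow C) : G.m f ≫ G.p f = G.p (G.R f) ≫ 𝟙 f.right :=
  (G.exists_extension (f := G.R f) (G.lifting f) (𝟙 _) (𝟙 _)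
    ((Category.id_comp _).trans (Category.comp_id _).symm)).choose_spec.choose

/-- The multiplication, as a square. -/
noncomputable abbrev mult (f : Arrow C) : G.R (G.R f) ⟶ G.R f :=
  Arrow.homMk (G.m f) (𝟙 f.right) (G.m_p' f)

lemma isHom_mult (f : Arrow C) : (G.lifting (G.R f)).IsHom (G.lifting f) (G.mult f) :=
  (G.exists_extension (f := G.R f) (G.lifting f) (𝟙 _) (𝟙 _)
    ((Category.id_comp _).trans (Category.comp_id _).symm)).choose_spec.choose_spec.1

lemma i_m (f : Arrow C) : G.i (G.R f) ≫ G.m f = 𝟙 (G.Z f) :=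
  (G.exists_extension (f := G.R f) (G.lifting f) (𝟙 _) (𝟙 _)
    ((Category.id_comp _).trans (Category.comp_id _).symm)).choose_spec.choose_spec.2

lemma i_m_assoc (f : Arrow C) {X : C} (k : G.Z f ⟶ X) :
    G.i (G.R f) ≫ G.m f ≫ k = k := by
  rw [← Category.assoc, i_m]
  exact Category.id_comp k

lemma m_p (f : Arrow C) : G.m f ≫ G.p f = G.p (G.R f) :=
  (G.m_p' f).trans (Category.comp_id _)

lemma m_p_assoc (f : Arrow C) {X : C} (k : f.right ⟶ X) :
    G.m f ≫ G.p f ≫ k = G.p (G.R f) ≫ k := by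
  rw [← Category.assoc, m_p]

/-- A square out of the right factor which is compatible with lifts is determined by its
restriction along the unit. -/
lemma extension_ext {f g : Arrow C} {ψ : RightLiftingFunction ι g} {t t' : G.R f ⟶ g}
    (ht : (G.lifting f).IsHom ψ t) (ht' : (G.lifting f).IsHom ψ t')
    (hi : G.i f ≫ t.left = G.i f ≫ t'.left) (hr : t.right = t'.right) : t.left = t'.left :=
  congr_arg Arrow.Hom.left (G.hom_ext ht ht' (Arrow.hom_ext _ _ hi (congr_arg (𝟙 _ ≫ ·) hr)))

lemma m_naturality {f g : Arrow C} (s : f ⟶ g) :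
    G.map (G.mapR s) ≫ G.m g = G.m f ≫ G.map s := by
  refine G.extension_ext ((G.isHom_mapR (G.mapR s)).comp (G.isHom_mult g))
    ((G.isHom_mult f).comp (G.isHom_mapR s)) ?_
    ((Category.comp_id _).trans (Category.id_comp _).symm)
  change G.i _ ≫ G.map _ ≫ G.m g = G.i _ ≫ G.m f ≫ G.map s
  rw [i_map_assoc, i_m, i_m_assoc]
  exact Category.comp_id (G.map s)

lemma m_assoc (f : Arrow C) : G.map (G.mult f) ≫ G.m f = G.m (G.R f) ≫ G.m f := by
  refine G.extension_ext ((G.isHom_mapR (G.mult f)).comp (G.isHom_mult f))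
    ((G.isHom_mult (G.R f)).comp (G.isHom_mult f)) ?_ rfl
  change G.i _ ≫ G.map _ ≫ G.m f = G.i _ ≫ G.m _ ≫ G.m f
  rw [i_map_assoc, i_m, i_m_assoc]
  exact Category.comp_id (G.m f)

/-- The unit, as a square. -/
abbrev unit (f : Arrow C) : f ⟶ G.R f :=
  Arrow.homMk (G.i f) (𝟙 f.right) ((G.i_p f).trans (Category.comp_id _).symm)

lemma map_unit_m (f : Arrow C) : G.map (G.unit f) ≫ G.m f = 𝟙 _ := by
  refine G.extension_ext ((G.isHom_mapR (G.unit f)).comp (G.isHom_mult f))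
    (G.lifting f).isHom_id ?_ (Category.comp_id _)
  change G.i f ≫ G.map _ ≫ G.m f = G.i f ≫ 𝟙 _
  rw [i_map_assoc, i_m]
  rfl

end Multiplication

section Comultiplication

/-- The lifting function on the composite of the right factors of `L f` and of `f`. -/
abbrev liftingComp (f : Arrow C) : RightLiftingFunction ι (Arrow.mk (G.p (G.L f) ≫ G.p f)) :=
  (G.lifting (G.L f)).comp (G.lifting f)

lemma comult_aux (f : Arrow C) : G.i (G.L f) ≫ G.p (G.L f) ≫ G.p f = f.hom ≫ 𝟙 f.right := by
  rw [i_p_assoc]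
  exact (G.i_p f).trans (Category.comp_id _).symm

/-- The comultiplication, as a map of `C`. -/
noncomputable def d (f : Arrow C) : G.Z f ⟶ G.Z (G.L f) :=
  (G.exists_extension (G.liftingComp f) _ _ (G.comult_aux f)).choose

lemma d_p_p (f : Arrow C) : G.d f ≫ G.p (G.L f) ≫ G.p f = G.p f ≫ 𝟙 f.right :=
  (G.exists_extension (G.liftingComp f) _ _ (G.comult_aux f)).choose_spec.choose

lemma isHom_d (f : Arrow C) : (G.lifting f).IsHom (G.liftingComp f)
    (Arrow.homMk (G.d f) (𝟙 f.right) (G.d_p_p f)) :=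
  (G.exists_extension (G.liftingComp f) _ _ (G.comult_aux f)).choose_spec.choose_spec.1

lemma i_d (f : Arrow C) : G.i f ≫ G.d f = G.i (G.L f) :=
  (G.exists_extension (G.liftingComp f) _ _ (G.comult_aux f)).choose_spec.choose_spec.2

lemma i_d_assoc (f : Arrow C) {X : C} (k : G.Z (G.L f) ⟶ X) :
    G.i f ≫ G.d f ≫ k = G.i (G.L f) ≫ k := by
  rw [← Category.assoc, i_d]

/-- The comultiplication, as a square. -/
noncomputable abbrev comult (f : Arrow C) : G.L f ⟶ G.L (G.L f) :=
  Arrow.homMk (𝟙 f.left) (G.d f) ((Category.id_comp _).trans (G.i_d f).symm)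

/-- The counit, as a square. -/
abbrev counit (f : Arrow C) : G.L f ⟶ f :=
  Arrow.homMk (𝟙 f.left) (G.p f) ((Category.id_comp _).trans (G.i_p f).symm)

lemma d_p (f : Arrow C) : G.d f ≫ G.p (G.L f) = 𝟙 (G.Z f) := by
  refine G.extension_ext ((G.isHom_d f).comp (RightLiftingFunction.isHom_comp_right
    (G.lifting (G.L f)) (G.lifting f) (Category.comp_id _).symm))
    (G.lifting f).isHom_id ?_ (Category.comp_id _)
  change G.i f ≫ G.d f ≫ G.p (G.L f) = G.i f ≫ 𝟙 _
  rw [i_d_assoc, i_p]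
  exact (Category.comp_id _).symm

lemma d_p_assoc (f : Arrow C) {X : C} (k : G.Z f ⟶ X) :
    G.d f ≫ G.p (G.L f) ≫ k = k := by
  rw [← Category.assoc, d_p, Category.id_comp]

lemma d_map_counit (f : Arrow C) : G.d f ≫ G.map (G.counit f) = 𝟙 (G.Z f) := by
  refine G.extension_ext ((G.isHom_d f).comp (RightLiftingFunction.isHom_comp_desc
    (G.lifting f) (G.isHom_mapR (G.counit f)) ((G.map_p _).trans (Category.comp_id _).symm)))
    (G.lifting f).isHom_id ?_ (Category.comp_id _)
  change G.i f ≫ G.d f ≫ G.map (G.counit f) = G.i f ≫ 𝟙 _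
  rw [i_d_assoc, i_map]
  exact (Category.id_comp _).trans (Category.comp_id _).symm

lemma d_naturality {f g : Arrow C} (s : f ⟶ g) :
    G.map s ≫ G.d g = G.d f ≫ G.map (G.mapL s) := by
  have hw : G.map (G.mapL s) ≫ G.p (G.L g) ≫ G.p g = (G.p (G.L f) ≫ G.p f) ≫ s.right := by
    rw [map_p_assoc, Category.assoc]
    exact congr_arg (G.p (G.L f) ≫ ·) (G.map_p s)
  refine G.extension_ext ((G.isHom_mapR s).comp (G.isHom_d g))
    ((G.isHom_d f).comp (RightLiftingFunction.isHom_comp_map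
      (G.isHom_mapR (G.mapL s)) (G.isHom_mapR s) hw)) ?_
    ((Category.comp_id _).trans (Category.id_comp _).symm)
  change G.i f ≫ G.map s ≫ G.d g = G.i f ≫ G.d f ≫ G.map (G.mapL s)
  rw [i_map_assoc, i_d, i_d_assoc, i_map]
  rfl

lemma d_coassoc (f : Arrow C) : G.d f ≫ G.map (G.comult f) = G.d f ≫ G.d (G.L f) := by
  have hw₁ : G.map (G.comult f) ≫ G.p (G.L (G.L f)) ≫ G.p (G.L f) ≫ G.p f =
      (G.p (G.L f) ≫ G.p f) ≫ 𝟙 f.right := by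
    rw [map_p_assoc, Category.assoc]
    exact congr_arg (G.p (G.L f) ≫ ·) (G.d_p_p f)
  have hw₂ : G.d (G.L f) ≫ (G.p (G.L (G.L f)) ≫ G.p (G.L f)) ≫ G.p f =
      (G.p (G.L f) ≫ G.p f) ≫ 𝟙 f.right := by
    have := G.d_p_p (G.L f)
    rw [← Category.assoc, this, Category.assoc, Category.assoc, Category.comp_id]
    exact congr_arg (G.p (G.L f) ≫ ·) (Category.id_comp _)
  -- The two bracketings of a triple composite are different arrows, so the second side of the
  -- comparison also passes through the identity-component square of `isHom_comp_assoc`.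
  have hw₃ : 𝟙 (G.Z (G.L (G.L f))) ≫ G.p (G.L (G.L f)) ≫ G.p (G.L f) ≫ G.p f =
      ((G.p (G.L (G.L f)) ≫ G.p (G.L f)) ≫ G.p f) ≫ 𝟙 f.right := by
    rw [Category.id_comp, Category.comp_id, Category.assoc]
  refine Eq.trans (G.extension_ext
    ((G.isHom_d f).comp (RightLiftingFunction.isHom_comp_map
      (G.isHom_mapR (G.comult f)) (G.isHom_d f) hw₁))
    (((G.isHom_d f).comp (RightLiftingFunction.isHom_comp_map
      (G.isHom_d (G.L f)) (G.lifting f).isHom_id hw₂)).comp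
      (RightLiftingFunction.isHom_comp_assoc _ _ _ hw₃)) ?_
    (Category.comp_id _).symm) (Category.comp_id _)
  change G.i f ≫ G.d f ≫ G.map (G.comult f) = G.i f ≫ (G.d f ≫ G.d (G.L f)) ≫ 𝟙 _
  rw [Category.comp_id, i_d_assoc, i_d_assoc, i_map]
  exact (Category.id_comp _).trans (G.i_d (G.L f)).symm

end Comultiplication

section Distributivity

/-- The comparison square between the left factor of `R f` and the right factor of `L f`. -/
noncomputable abbrev distrib (f : Arrow C) : G.L (G.R f) ⟶ G.R (G.L f) :=
  Arrow.homMk (G.d f) (G.m f) ((G.d_p f).trans (G.i_m f).symm)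

/-- Both sides preserve lifts from `R (R f)` into the composite of `R (L f)` and `R f`, and both
restrict to `d f` along the unit. This is the only component of the distributive law that is not
already a monad or comonad identity or a structural equation of `m` and `d`. -/
lemma m_d (f : Arrow C) :
    G.m f ≫ G.d f = G.d (G.R f) ≫ G.map (G.distrib f) ≫ G.m (G.L f) := by
  have hw₁ : G.map (G.distrib f) ≫ G.p (G.R (G.L f)) ≫ G.p f =
      (G.p (G.L (G.R f)) ≫ G.p (G.R f)) ≫ 𝟙 f.right := by
    rw [map_p_assoc, Category.assoc]
    exact congr_arg (G.p (G.L (G.R f)) ≫ ·) (G.m_p' f)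
  have hw₂ : G.m (G.L f) ≫ G.p (G.L f) ≫ G.p f =
      (G.p (G.R (G.L f)) ≫ G.p f) ≫ 𝟙 f.right := by
    rw [m_p_assoc]
    exact (Category.comp_id _).symm
  refine G.extension_ext ((G.isHom_mult f).comp (G.isHom_d f))
    ((G.isHom_d (G.R f)).comp ((RightLiftingFunction.isHom_comp_map
      (G.isHom_mapR (G.distrib f)) (G.isHom_mult f) hw₁).comp
      (RightLiftingFunction.isHom_comp_map (G.isHom_mult (G.L f))
        (G.lifting f).isHom_id hw₂))) ?_
    (congr_arg (𝟙 f.right ≫ ·) (Category.comp_id (𝟙 f.right)).symm)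
  change G.i _ ≫ G.m f ≫ G.d f = G.i _ ≫ G.d (G.R f) ≫ G.map (G.distrib f) ≫ G.m (G.L f)
  rw [i_m_assoc, i_d_assoc, i_map_assoc, i_m]
  exact (Category.comp_id (G.d f)).symm

end Distributivity

/-- The algebraic weak factorization system determined by the free objects of `I^⧄`. -/
noncomputable def algebraicWFS : AlgebraicWFS C where
  F := G.F
  δ :=
    { app := fun f ↦ G.comult f
      naturality := fun _ _ s ↦ Arrow.hom_ext _ _
        ((Category.comp_id s.left).trans (Category.id_comp s.left).symm) (G.d_naturality s) }
  δ_left _ := rfl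
  coassoc f := Arrow.hom_ext _ _ rfl (G.d_coassoc f)
  left_counit f := Arrow.hom_ext _ _ (Category.comp_id _) (G.d_p f)
  right_counit f := Arrow.hom_ext _ _ (Category.comp_id _) (G.d_map_counit f)
  μ :=
    { app := fun f ↦ G.mult f
      naturality := fun _ _ s ↦ Arrow.hom_ext _ _ (G.m_naturality s)
        ((Category.comp_id s.right).trans (Category.id_comp s.right).symm) }
  μ_right _ := rfl
  assoc f := Arrow.hom_ext _ _ (G.m_assoc f) rfl
  left_unit f := Arrow.hom_ext _ _ (G.i_m f) (Category.comp_id _)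
  right_unit f := Arrow.hom_ext _ _ (G.map_unit_m f) (Category.comp_id _)
  distrib_unit f := Arrow.hom_ext _ _ (G.i_d f) (G.map_unit_m f)
  distrib_counit f := Arrow.hom_ext _ _ (G.d_map_counit f) (G.m_p f)
  distrib_mul f := Arrow.hom_ext _ _ (G.m_d f)
    ((G.m_assoc f).trans (congr_arg _ (Category.comp_id _).symm))
  distrib_comul f := Arrow.hom_ext _ _ ((Category.id_comp _).trans (G.d_coassoc f).symm)
    (G.m_d f).symm

end FreeFactorization

/-! ### Identification of the two classes -/

section Classes

variable {C : Type u} [Category.{v} C] {I : Type w} [Category.{w'} I] {ι : I ⥤ Arrow C}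

/-- The left lifting function induced on a retract. -/
def LeftLiftingFunction.ofRetract {K : Type w} [Category.{w'} K] {U : K ⥤ Arrow C}
    {f g : Arrow C} (φ : LeftLiftingFunction U f) (i : g ⟶ f) (r : f ⟶ g)
    (hir : i ≫ r = 𝟙 g) : LeftLiftingFunction U g where
  lift k σ := i.right ≫ φ.lift k (r ≫ σ)
  fac_left k σ := by
    rw [← Category.assoc, ← Arrow.w, Category.assoc, φ.fac_left, ← Arrow.comp_left,
      ← Category.assoc, hir, Category.id_comp]
  fac_right k σ := by
    rw [Category.assoc, φ.fac_right, ← Arrow.comp_right, ← Category.assoc, hir,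
      Category.id_comp]
  natural m σ := by rw [← Category.assoc, φ.natural, Category.assoc]

instance : (rightClass ι).IsStableUnderRetracts where
  of_retract h := fun ⟨φ⟩ ↦ ⟨φ.ofRetract h.i h.r h.retract⟩

instance : (leftClass ι).IsStableUnderRetracts where
  of_retract h := fun ⟨φ⟩ ↦ ⟨φ.ofRetract h.i h.r h.retract⟩

lemma hasLiftingProperty_of_leftClass_rightClass {A B X Y : C} (i : A ⟶ B) (p : X ⟶ Y)
    (hi : leftClass ι i) (hp : rightClass ι p) : HasLiftingProperty i p := by
  obtain ⟨φ⟩ := hi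
  obtain ⟨ψ⟩ := hp
  refine ⟨fun {f g} sq ↦ ⟨⟨⟨φ.lift ⟨Arrow.mk p, ψ⟩ (Arrow.homMk f g sq.w), ?_, ?_⟩⟩⟩⟩
  · exact φ.fac_left _ _
  · exact φ.fac_right _ _

namespace FreeFactorization

variable (G : FreeFactorization ι)

lemma exists_algebra {f : Arrow C} (ψ : RightLiftingFunction ι f) :
    ∃ (x : G.Z f ⟶ f.left) (h : x ≫ f.hom = G.p f ≫ 𝟙 _),
      (G.lifting f).IsHom ψ (Arrow.homMk x (𝟙 _) h) ∧ G.i f ≫ x = 𝟙 _ :=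
  G.exists_extension ψ (𝟙 _) (𝟙 _) ((Category.id_comp _).trans (Category.comp_id _).symm)

lemma rightClass_p (f : Arrow C) : rightClass ι (G.p f) := ⟨G.lifting f⟩

/-- An object `K` of `I^⧄` has a canonical retraction `x K` of its unit, by freeness; lifts are
comultiplication, then functoriality, then `x K`. Naturality in `K` reduces to that of `x`, again by
freeness. -/
lemma leftClass_i (f : Arrow C) : leftClass ι (G.i f) := by
  choose x hx hφ hi using fun K : RightLifting ι ↦ G.exists_algebra K.φ
  have h₁ (K : RightLifting ι) (σ : G.L f ⟶ K.arrow) :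
      G.i f ≫ G.d f ≫ G.map σ ≫ x K = σ.left := by
    rw [i_d_assoc, i_map_assoc, hi]
    exact Category.comp_id σ.left
  have h₂ (K : RightLifting ι) (σ : G.L f ⟶ K.arrow) :
      (G.d f ≫ G.map σ ≫ x K) ≫ K.arrow.hom = σ.right := by
    rw [Category.assoc, Category.assoc, hx, Category.comp_id, map_p, d_p_assoc]
  have h₃ {K K' : RightLifting ι} (t : K ⟶ K') : G.map t.f ≫ x K' = x K ≫ t.f.left := by
    refine G.extension_ext ((G.isHom_mapR t.f).comp (hφ K'))
      (RightLiftingFunction.IsHom.comp (hφ K) t.comm) ?_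
      ((Category.comp_id _).trans (Category.id_comp _).symm)
    change G.i _ ≫ G.map _ ≫ x K' = G.i _ ≫ x K ≫ t.f.left
    rw [i_map_assoc, hi, reassoc_of% (hi K)]
    exact Category.comp_id _
  have h₄ {K K' : RightLifting ι} (t : K ⟶ K') (σ : G.L f ⟶ K.arrow) :
      G.d f ≫ G.map (σ ≫ t.f) ≫ x K' = (G.d f ≫ G.map σ ≫ x K) ≫ t.f.left := by
    rw [map_comp_assoc, h₃, Category.assoc, Category.assoc]
  exact ⟨{
    lift := fun K σ ↦ G.d f ≫ G.map σ ≫ x K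
    fac_left := h₁
    fac_right := h₂
    natural := h₄ }⟩

theorem isWeakFactorizationSystem (G : FreeFactorization ι) :
    MorphismProperty.IsWeakFactorizationSystem (leftClass ι) (rightClass ι) := by
  have : MorphismProperty.HasFactorization (leftClass ι) (rightClass ι) :=
    ⟨fun f ↦ ⟨{
      Z := G.Z (Arrow.mk f)
      i := G.i (Arrow.mk f)
      p := G.p (Arrow.mk f)
      fac := G.i_p (Arrow.mk f)
      hi := G.leftClass_i _
      hp := G.rightClass_p _ }⟩⟩
  exact .mk' _ _ hasLiftingProperty_of_leftClass_rightClass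

/-- The counit law makes a coalgebra a retract of its left factor. Conversely, lifting `f` against
its own right factor makes `f` a retract of the cofree coalgebra `L f`. -/
theorem algebraicWFS_left : G.algebraicWFS.left = leftClass ι := by
  apply le_antisymm
  · rintro X Y f ⟨Z, W, g, r, ⟨A, a, ha, _⟩, hK⟩
    refine MorphismProperty.of_retract r ?_
    obtain rfl : A = Arrow.mk g := hK
    obtain ⟨φ⟩ := G.leftClass_i (Arrow.mk g)
    exact ⟨φ.ofRetract a (G.counit _) ha⟩
  · intro X Y f hf
    have := hasLiftingProperty_of_leftClass_rightClass f (G.p (Arrow.mk f)) hf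
      (G.rightClass_p _)
    exact ⟨_, _, G.i (Arrow.mk f), RetractArrow.ofLeftLiftingProperty (G.i_p (Arrow.mk f)),
      (G.algebraicWFS.comonad.cofree).obj (Arrow.mk f), rfl⟩

/-- The unit law makes an algebra a retract of its right factor. In the other direction no retract
is needed: freeness turns a lifting function on `f` into an algebra structure on `f` itself. -/
theorem algebraicWFS_right : G.algebraicWFS.right = rightClass ι := by
  apply le_antisymm
  · rintro X Y f ⟨Z, W, g, r, ⟨A, a, ha, _⟩, hK⟩
    refine MorphismProperty.of_retract r ?_
    obtain rfl : A = Arrow.mk g := hK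
    exact ⟨(G.lifting (Arrow.mk g)).ofRetract (G.unit _) a ha⟩
  · rintro X Y f ⟨ψ⟩
    obtain ⟨x, hx, hφ, hi⟩ := G.exists_algebra ψ
    let s : G.R (Arrow.mk f) ⟶ Arrow.mk f := Arrow.homMk x (𝟙 _) hx
    refine MorphismProperty.le_retracts _ _ ⟨{
      A := Arrow.mk f
      a := s
      unit := Arrow.hom_ext _ _ hi (Category.comp_id _)
      assoc := Arrow.hom_ext _ _ ?_ rfl }, rfl⟩
    refine G.extension_ext ((G.isHom_mult _).comp hφ)
      ((G.isHom_mapR s).comp hφ) ?_ rfl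
    change G.i _ ≫ G.m _ ≫ x = G.i _ ≫ G.map _ ≫ x
    rw [i_m_assoc, i_map_assoc, hi]
    exact (Category.comp_id x).symm

end FreeFactorization

end Classes

end AlgSOA

theorem mainTheorem3 {C : Type u} [Category.{v} C] [HasLimits C] [HasColimits C]
    {I : Type w} [Category.{w'} I]
    -- `ι` exhibits `I` as a (not necessarily full) subcategory of the arrow category
    (ι : I ⥤ Arrow C) [ι.Faithful] (hι : Function.Injective ι.obj)
    (R : AlgSOA.PointedEndofunctorOverCod C)
    (e : AlgSOA.IsoOver (AlgSOA.RightLifting.forget ι)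
      (AlgSOA.PointedEndofunctorOverCod.Algebra.forget R))
    (hR : AlgSOA.SmallnessCondition R.R) :
    ∃ A : AlgSOA.AlgebraicWFS C,
      (MorphismProperty.IsWeakFactorizationSystem
          (AlgSOA.leftClass ι) (AlgSOA.rightClass ι) ∧
        A.left = AlgSOA.leftClass ι ∧ A.right = AlgSOA.rightClass ι) ∧
      ∀ {X Y : C} (f : X ⟶ Y),
        AlgSOA.leftClass ι (A.F.i.app (Arrow.mk f)) ∧
        AlgSOA.rightClass ι (A.F.p.app (Arrow.mk f)) ∧
        A.F.i.app (Arrow.mk f) ≫ A.F.p.app (Arrow.mk f) = f := by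
  obtain ⟨G⟩ := AlgSOA.nonempty_freeFactorization (ι := ι)
    (AlgSOA.exists_free_rightLifting R e hR)
  exact ⟨G.algebraicWFS, ⟨G.isWeakFactorizationSystem, G.algebraicWFS_left,
    G.algebraicWFS_right⟩, fun f ↦ ⟨G.leftClass_i _, G.rightClass_p _, G.i_p _⟩⟩
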